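/- **FKN theorem for the slice.** For integers $0\le k\le n$ let $\binom{[n]}{k}=\{x\in\{0,1\}^n:\sum_i x_i=k\}$ with the uniform distribution, and put $\|g\|^2=\mathbb{E}[g^2]$ for $g\colon\binom{[n]}{k}\to\mathbb{R}$. Two functions $g,h$ are called $\epsilon$-close if $\|g-h\|^2\le\epsilon$. An affine function is one of the form $x\mapsto c_0+\sum_{i=1}^n c_ix_i$ with real $c_0,\dots,c_n$. By convention $\max_{i\in\emptyset}x_i=0$ and $\min_{i\in\emptyset}x_i=1$. There exist absolute constants $C_1,C_2,c>0$ such that the following holds for all integers $n,k$ with $2\le k\le n-2$, all real $\epsilon$, and all $f\colon\binom{[n]}{k}\to\{0,1\}$ that are $\epsilon$-close to an affine function. Let $p=\min(k/n,1-k/n)$. 1. If $k\le n/2$, then there is a set $S\subseteq[n]$ with $|S|\le\max(1,C_2\sqrt{\epsilon}/p)$ such that $f$ or $1-f$ is $C_1\epsilon$-close to $\max_{i\in S}x_i$. 2. If $k\ge n/2$, then there is a set $S\subseteq[n]$ with $|S|\le\max(1,C_2\sqrt{\epsilon}/p)$ such that $f$ or $1-f$ is $C_1\epsilon$-close to $\min_{i\in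 S}x_i$. 3. In particular, if $\epsilon\le c\,p^2$, then $f$ is $C_1\epsilon$-close to one of the functions $0,\ 1,\ x_i,\ 1-x_i$ ($i\in[n]$). -/

import Mathlib

namespace SliceFKN

open scoped BigOperators

/-- The slice: the subsets of `[n]` of size exactly `k`, i.e. the vectors in `{0,1}^n`
with coordinate sum `k`. -/
abbrev Slice (n k : ℕ) : Type := {A : Finset (Fin n) // A.card = k}

/-- The `i`-th coordinate `x_i ∈ {0,1}` of a point of the slice. -/
def coord {n k : ℕ} (i : Fin n) (x : Slice n k) : ℝ := if i ∈ x.1 then 1 else 0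

/-- The squared `L₂` norm `𝔼[f²]` with respect to the uniform distribution on a finite domain. -/
noncomputable def sqNorm {D : Type} [Fintype D] (f : D → ℝ) : ℝ :=
  Finset.expect Finset.univ fun x => f x ^ 2

/-- `f` and `g` are `ε`-close: `‖f - g‖² ≤ ε`. -/
def IsClose {D : Type} [Fintype D] (ε : ℝ) (f g : D → ℝ) : Prop :=
  sqNorm (fun x => f x - g x) ≤ ε

/-- A Boolean function is a `{0,1}`-valued function. -/
def IsBoolean {D : Type} (f : D → ℝ) : Prop := ∀ x, f x = 0 ∨ f x = 1

/-- Affine functions `c₀ + ∑ i, c i * x_i` on the slice. -/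
def IsAffine {n k : ℕ} (l : Slice n k → ℝ) : Prop :=
  ∃ (c₀ : ℝ) (c : Fin n → ℝ), ∀ x, l x = c₀ + ∑ i, c i * coord i x

/-- `max_{i ∈ S} x_i`, with the convention `max ∅ = 0`. -/
noncomputable def maxCoord {n k : ℕ} (S : Finset (Fin n)) (x : Slice n k) : ℝ :=
  S.fold max 0 fun i => coord i x

/-- `min_{i ∈ S} x_i`, with the convention `min ∅ = 1`. -/
noncomputable def minCoord {n k : ℕ} (S : Finset (Fin n)) (x : Slice n k) : ℝ :=
  S.fold min 1 fun i => coord i x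

/-- `p = min(k/n, 1 - k/n)`. -/
noncomputable def density (n k : ℕ) : ℝ := min ((k : ℝ) / n) (1 - (k : ℝ) / n)

end SliceFKN

/-!
Choosing one element from each of `k` random disjoint pairs gives a random subcube of the slice, on
which `f` is on average still close to an affine function. The Friedgut–Kalai–Naor theorem on the
cube then says that at most one of the differences of the coefficients inside the pairs is far
from `0`, and that this one is close to an integer. Averaging over the pairs, the affine function
can be rounded to an integral one: the rounding errors of the coefficients, measured from a suitable
one of them, have small second moment, hence contribute little variance, and the constant term can
be rounded because `f` takes integral values.

On the slice the coefficients may all be shifted by a common integer at the cost of changing the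
constant. After subtracting their median, few of them are nonzero, so a random point avoids the
remaining part of the support with probability bounded below, conditionally on any trace on it.
Each trace at which the integral function is not `0` or `1` therefore contributes a constant
fraction of its probability to the error. The empty trace shows that the constant is `0` or `1`, so
that up to replacing `f` by `1 - f` it is `0`. Unless a bad trace occurs, the function then agrees
with the maximum of the coordinates with coefficient `1`, and the pairs of such coordinates, all of
which are bad, bound their number. Complementation exchanges the two halves `k ≤ n / 2` and
`k ≥ n / 2`.
-/

namespace SliceFKN

open scoped BigOperators
open Finset

section Boolean

lemma IsBoolean.one_sub {D : Type} {f : D → ℝ} (hf : IsBoolean f) :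
    IsBoolean fun x => 1 - f x := fun x => by
  rcases hf x with h | h <;> simp [h]

lemma IsBoolean.exists_int_eq_sub {D : Type} {f : D → ℝ} (hf : IsBoolean f) (x y : D) :
    ∃ d : ℤ, d ^ 2 ≤ 1 ∧ (d : ℝ) = f x - f y := by
  rcases hf x with hx | hx <;> rcases hf y with hy | hy <;> rw [hx, hy]
  exacts [⟨0, by simp⟩, ⟨-1, by simp⟩, ⟨1, by simp⟩, ⟨0, by simp⟩]

lemma sq_sub_le_one {u v : ℝ} (hu : u = 0 ∨ u = 1) (hv : v = 0 ∨ v = 1) : (u - v) ^ 2 ≤ 1 := by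
  rcases hu with rfl | rfl <;> rcases hv with rfl | rfl <;> norm_num

lemma one_le_sq_intCast {m : ℤ} (hm : m ≠ 0) : (1 : ℝ) ≤ (m : ℝ) ^ 2 := by
  have : 1 ≤ m ^ 2 := Int.add_one_le_iff.mpr (sq_pos_of_ne_zero hm)
  exact_mod_cast this

lemma one_le_sq_sub_intCast {u : ℝ} (hu : u = 0 ∨ u = 1) {m : ℤ} (h₀ : m ≠ 0) (h₁ : m ≠ 1) :
    1 ≤ (u - m) ^ 2 := by
  rcases hu with rfl | rfl
  · exact_mod_cast one_le_sq_intCast (sub_ne_zero.mpr h₀.symm)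
  · exact_mod_cast one_le_sq_intCast (sub_ne_zero.mpr h₁.symm)

lemma sqNorm_nonneg {D : Type} [Fintype D] (f : D → ℝ) : 0 ≤ sqNorm f :=
  expect_nonneg fun _ _ => sq_nonneg _

lemma isClose_one_sub {D : Type} [Fintype D] {ε : ℝ} {f g : D → ℝ} :
    IsClose ε (fun x => 1 - f x) g ↔ IsClose ε f fun x => 1 - g x := by
  have h : ∀ x, (1 - f x - g x) ^ 2 = (f x - (1 - g x)) ^ 2 := fun x => by ring
  simp only [IsClose, sqNorm, h]

end Boolean

section Cube

variable {ι : Type}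

/-- The value `±1` of the `i`-th bit of a point of the cube `ι → Bool`. -/
def sgn (y : ι → Bool) (i : ι) : ℝ := if y i then 1 else -1

/-- The Rademacher sum over `A` with weights `w`. -/
def rad (w : ι → ℝ) (A : Finset ι) (y : ι → Bool) : ℝ := ∑ i ∈ A, w i * sgn y i

lemma sgn_eq_or (y : ι → Bool) (i : ι) : sgn y i = 1 ∨ sgn y i = -1 := by
  unfold sgn; split_ifs <;> simp

lemma sgn_sq (y : ι → Bool) (i : ι) : sgn y i ^ 2 = 1 := by
  rcases sgn_eq_or y i with h | h <;> rw [h] <;> norm_num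

lemma dependsOn_rad (w : ι → ℝ) (A : Finset ι) : DependsOn (rad w A) A := fun y z hyz =>
  sum_congr rfl fun i hi => by rw [sgn, sgn, hyz i hi]

variable [DecidableEq ι]

lemma rad_insert (w : ι → ℝ) {A : Finset ι} {i : ι} (hi : i ∉ A) (y : ι → Bool) :
    rad w (insert i A) y = w i * sgn y i + rad w A y := sum_insert hi

/-- The reflection of the cube which flips the bits in `A`. -/
def flipOn (A : Finset ι) (y : ι → Bool) : ι → Bool := fun i => if i ∈ A then !(y i) else y i

lemma flipOn_involutive (A : Finset ι) : Function.Involutive (flipOn A) := fun y => by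
  funext i
  by_cases h : i ∈ A <;> simp [flipOn, h]

lemma sgn_flipOn (A : Finset ι) (y : ι → Bool) (i : ι) :
    sgn (flipOn A y) i = if i ∈ A then -sgn y i else sgn y i := by
  by_cases h : i ∈ A <;> cases hy : y i <;> simp [sgn, flipOn, h, hy]

variable [Fintype ι]

lemma rad_flipOn (w : ι → ℝ) (A : Finset ι) (y : ι → Bool) :
    rad w univ (flipOn A y) = rad w univ y - 2 * rad w A y := by
  have hA : rad w A y = ∑ i, if i ∈ A then w i * sgn y i else 0 := by simp [rad]
  rw [hA, rad, rad, mul_sum, ← sum_sub_distrib]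
  refine sum_congr rfl fun i _ => ?_
  rw [sgn_flipOn]
  split_ifs <;> ring

lemma expect_flipOn (A : Finset ι) (Φ : (ι → Bool) → ℝ) :
    (𝔼 y, Φ (flipOn A y)) = 𝔼 y, Φ y :=
  Fintype.expect_equiv (flipOn_involutive A).toPerm _ _ fun _ => rfl

lemma expect_sgn_mul {i : ι} {Φ : (ι → Bool) → ℝ} (h : DependsOn Φ {i}ᶜ) :
    (𝔼 y, sgn y i * Φ y) = 0 := by
  have hΦ : ∀ y, Φ (flipOn {i} y) = Φ y := fun y => h fun j hj => by
    rw [Set.mem_compl_singleton_iff] at hj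
    simp [flipOn, hj]
  have := expect_flipOn {i} fun y => sgn y i * Φ y
  simp only [hΦ, sgn_flipOn, mem_singleton, if_true, neg_mul, expect_neg_distrib] at this
  linarith

lemma expect_rad_sq_mul (w : ι → ℝ) (A : Finset ι) {Ψ : (ι → Bool) → ℝ}
    (hΨ : DependsOn Ψ (A : Set ι)ᶜ) :
    (𝔼 y, rad w A y ^ 2 * Ψ y) = (∑ i ∈ A, w i ^ 2) * 𝔼 y, Ψ y := by
  induction A using Finset.induction_on with
  | empty => simp [rad]
  | insert i A hi ih =>
    rw [coe_insert] at hΨ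
    have hr : DependsOn (rad w A) {i}ᶜ := (dependsOn_rad w A).mono (by simpa using hi)
    have hΨi : DependsOn Ψ {i}ᶜ := hΨ.mono (by simp)
    have cross : (𝔼 y, sgn y i * (rad w A y * Ψ y)) = 0 :=
      expect_sgn_mul fun y z hyz => by simp only [hr hyz, hΨi hyz]
    have expand : ∀ y, rad w (insert i A) y ^ 2 * Ψ y =
        w i ^ 2 * Ψ y + 2 * w i * (sgn y i * (rad w A y * Ψ y)) + rad w A y ^ 2 * Ψ y := fun y => by
      rw [rad_insert w hi]
      linear_combination (w i ^ 2 * Ψ y) * sgn_sq y i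
    simp only [expand, expect_add_distrib, ← mul_expect, cross,
      ih (hΨ.mono (Set.compl_subset_compl.mpr (Set.subset_insert _ _))), sum_insert hi]
    ring

lemma expect_rad_sq (w : ι → ℝ) (A : Finset ι) : (𝔼 y, rad w A y ^ 2) = ∑ i ∈ A, w i ^ 2 := by
  simpa using expect_rad_sq_mul w A (Ψ := fun _ => 1) fun _ _ _ => rfl

lemma expect_rad_pow_four_mul_le (w : ι → ℝ) (A : Finset ι) {Ψ : (ι → Bool) → ℝ}
    (hΨ : DependsOn Ψ (A : Set ι)ᶜ) (hΨ₀ : ∀ y, 0 ≤ Ψ y) :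
    (𝔼 y, rad w A y ^ 4 * Ψ y) ≤ 3 * (∑ i ∈ A, w i ^ 2) ^ 2 * 𝔼 y, Ψ y := by
  induction A using Finset.induction_on with
  | empty => simp [rad]
  | insert i A hi ih =>
    rw [coe_insert] at hΨ
    have hr : DependsOn (rad w A) {i}ᶜ := (dependsOn_rad w A).mono (by simpa using hi)
    have hΨi : DependsOn Ψ {i}ᶜ := hΨ.mono (by simp)
    have hΨA : DependsOn Ψ (A : Set ι)ᶜ :=
      hΨ.mono (Set.compl_subset_compl.mpr (Set.subset_insert _ _))
    have cross₁ : (𝔼 y, sgn y i * (rad w A y * Ψ y)) = 0 :=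
      expect_sgn_mul fun y z hyz => by simp only [hr hyz, hΨi hyz]
    have cross₃ : (𝔼 y, sgn y i * (rad w A y ^ 3 * Ψ y)) = 0 :=
      expect_sgn_mul fun y z hyz => by simp only [hr hyz, hΨi hyz]
    have expand : ∀ y, rad w (insert i A) y ^ 4 * Ψ y =
        w i ^ 4 * Ψ y + (4 * w i ^ 3) * (sgn y i * (rad w A y * Ψ y))
          + (6 * w i ^ 2) * (rad w A y ^ 2 * Ψ y)
          + (4 * w i) * (sgn y i * (rad w A y ^ 3 * Ψ y)) + rad w A y ^ 4 * Ψ y := fun y => by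
      rw [rad_insert w hi]
      linear_combination (w i ^ 4 * Ψ y * (sgn y i ^ 2 + 1)
        + 4 * w i ^ 3 * sgn y i * rad w A y * Ψ y
        + 6 * w i ^ 2 * rad w A y ^ 2 * Ψ y) * sgn_sq y i
    simp only [expand, expect_add_distrib, ← mul_expect, cross₁, cross₃,
      expect_rad_sq_mul w A hΨA, sum_insert hi]
    nlinarith [ih hΨA, mul_nonneg (pow_nonneg (sq_nonneg (w i)) 2)
      (expect_nonneg fun y (_ : y ∈ univ) => hΨ₀ y)]

lemma quadratic_le_min {a b : ℝ} (ha : 0 ≤ a) (hb : 0 ≤ b) (M : ℝ) :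
    2 * M * (a * b) - (a ^ 2 * b + b ^ 2 * a) ≤ M ^ 2 * min a b := by
  rcases le_total a b with h | h
  · rw [min_eq_left h]
    nlinarith [mul_nonneg ha (sq_nonneg (M - b)), mul_nonneg (mul_nonneg ha ha) hb]
  · rw [min_eq_right h]
    nlinarith [mul_nonneg hb (sq_nonneg (M - a)), mul_nonneg (mul_nonneg hb hb) ha]

lemma sum_sq_mul_sum_sq_le_expect_min (w : ι → ℝ) {A B : Finset ι} (hAB : Disjoint A B) :
    (∑ i ∈ A, w i ^ 2) * ∑ i ∈ B, w i ^ 2 ≤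
      3 * (∑ i ∈ A, w i ^ 2 + ∑ i ∈ B, w i ^ 2) * 𝔼 y, min (rad w A y ^ 2) (rad w B y ^ 2) := by
  have hA : DependsOn (fun y => rad w B y ^ 2) (A : Set ι)ᶜ := fun y z hyz => by
    simp only [(dependsOn_rad w B).mono (disjoint_coe.mpr hAB).subset_compl_left hyz]
  have hB : DependsOn (fun y => rad w A y ^ 2) (B : Set ι)ᶜ := fun y z hyz => by
    simp only [(dependsOn_rad w A).mono (disjoint_coe.mpr hAB).subset_compl_right hyz]
  have m₂₂ := expect_rad_sq_mul w A hA
  have m₄₂ := expect_rad_pow_four_mul_le w A hA fun y => sq_nonneg _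
  have m₂₄ := expect_rad_pow_four_mul_le w B hB fun y => sq_nonneg _
  simp only [expect_rad_sq] at m₂₂ m₄₂ m₂₄
  have hs : 0 ≤ ∑ i ∈ A, w i ^ 2 := sum_nonneg fun i _ => sq_nonneg _
  have ht : 0 ≤ ∑ i ∈ B, w i ^ 2 := sum_nonneg fun i _ => sq_nonneg _
  generalize ∑ i ∈ A, w i ^ 2 = s at *
  generalize ∑ i ∈ B, w i ^ 2 = t at *
  rcases (add_nonneg hs ht).eq_or_lt with h₀ | hpos
  · rw [← h₀, mul_zero, zero_mul]
    nlinarith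
  have hq := expect_le_expect (s := univ) fun y _ =>
    quadratic_le_min (sq_nonneg (rad w A y)) (sq_nonneg (rad w B y)) (3 * (s + t))
  simp only [expect_sub_distrib, expect_add_distrib, ← mul_expect, ← pow_mul] at hq
  norm_num only [m₂₂] at hq
  refine le_of_mul_le_mul_left ?_ hpos
  nlinarith

lemma min_sum_sq_le_expect_min (w : ι → ℝ) {A B : Finset ι} (hAB : Disjoint A B) :
    min (∑ i ∈ A, w i ^ 2) (∑ i ∈ B, w i ^ 2) ≤
      6 * 𝔼 y, min (rad w A y ^ 2) (rad w B y ^ 2) := by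
  have hE : 0 ≤ 𝔼 y, min (rad w A y ^ 2) (rad w B y ^ 2) :=
    expect_nonneg fun y _ => le_min (sq_nonneg _) (sq_nonneg _)
  have hmul := sum_sq_mul_sum_sq_le_expect_min w hAB
  have hs : 0 ≤ ∑ i ∈ A, w i ^ 2 := sum_nonneg fun i _ => sq_nonneg _
  have ht : 0 ≤ ∑ i ∈ B, w i ^ 2 := sum_nonneg fun i _ => sq_nonneg _
  generalize ∑ i ∈ A, w i ^ 2 = s at *
  generalize ∑ i ∈ B, w i ^ 2 = t at *
  rcases (add_nonneg hs ht).eq_or_lt with h₀ | hpos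
  · exact (min_le_left s t).trans (by linarith)
  have hmin : (s + t) * min s t ≤ 2 * (s * t) := by
    nlinarith [mul_nonneg hs (sub_nonneg.mpr (min_le_right s t)),
      mul_nonneg ht (sub_nonneg.mpr (min_le_left s t))]
  refine le_of_mul_le_mul_left ?_ hpos
  linarith

lemma sq_sub_le_of_alternating {r₀₀ r₁₀ r₀₁ r₁₁ u₀₀ u₁₀ u₀₁ u₁₁ : ℝ}
    (hbottom : (r₀₀ - r₁₀) ^ 2 = 1) (htop : r₁₁ - r₀₁ = r₀₀ - r₁₀) (hu : u₀₀ + u₁₁ = u₁₀ + u₀₁) :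
    (u₀₀ - u₁₀) ^ 2 ≤
      6 * ((r₀₀ - u₀₀) ^ 2 + (r₁₀ - u₁₀) ^ 2 + (r₀₁ - u₀₁) ^ 2 + (r₁₁ - u₁₁) ^ 2) := by
  have htotal : 1 ≤ (r₀₀ - u₀₀) ^ 2 + (r₁₀ - u₁₀) ^ 2 + (r₀₁ - u₀₁) ^ 2 + (r₁₁ - u₁₁) ^ 2 := by
    have hsum : (r₀₀ - u₀₀) + (r₁₁ - u₁₁) - (r₁₀ - u₁₀) - (r₀₁ - u₀₁) = 2 * (r₀₀ - r₁₀) := by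
      linarith
    generalize r₀₀ - u₀₀ = d₀₀ at *
    generalize r₁₀ - u₁₀ = d₁₀ at *
    generalize r₀₁ - u₀₁ = d₀₁ at *
    generalize r₁₁ - u₁₁ = d₁₁ at *
    have : (d₀₀ + d₁₁ - d₁₀ - d₀₁) ^ 2 = 4 := by rw [hsum]; linear_combination 4 * hbottom
    nlinarith [sq_nonneg (d₀₀ - d₁₁), sq_nonneg (d₁₀ - d₀₁), sq_nonneg (d₀₀ + d₁₀),
      sq_nonneg (d₀₀ + d₀₁), sq_nonneg (d₁₁ + d₁₀), sq_nonneg (d₁₁ + d₀₁)]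
  have hside : (u₀₀ - u₁₀) ^ 2 ≤
      2 * (r₀₀ - r₁₀) ^ 2 + 4 * ((r₀₀ - u₀₀) ^ 2 + (r₁₀ - u₁₀) ^ 2) := by
    nlinarith [sq_nonneg ((r₀₀ - r₁₀) + ((r₀₀ - u₀₀) - (r₁₀ - u₁₀))),
      sq_nonneg ((r₀₀ - u₀₀) + (r₁₀ - u₁₀))]
  linarith [sq_nonneg (r₀₁ - u₀₁), sq_nonneg (r₁₁ - u₁₁)]

lemma min_sq_sub_le_of_add_eq_add {r₀₀ r₁₀ r₀₁ r₁₁ u₀₀ u₁₀ u₀₁ u₁₁ : ℝ}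
    (h₀₀ : r₀₀ = 0 ∨ r₀₀ = 1) (h₁₀ : r₁₀ = 0 ∨ r₁₀ = 1) (h₀₁ : r₀₁ = 0 ∨ r₀₁ = 1)
    (h₁₁ : r₁₁ = 0 ∨ r₁₁ = 1) (hu : u₀₀ + u₁₁ = u₁₀ + u₀₁) :
    min ((u₀₀ - u₁₀) ^ 2) ((u₀₀ - u₀₁) ^ 2) ≤
      6 * ((r₀₀ - u₀₀) ^ 2 + (r₁₀ - u₁₀) ^ 2 + (r₀₁ - u₀₁) ^ 2 + (r₁₁ - u₁₁) ^ 2) := by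
  rw [min_le_iff]
  have side : ∀ r u v : ℝ, (u - v) ^ 2 ≤ 2 * ((r - u) ^ 2 + (r - v) ^ 2) := fun r u v => by
    nlinarith [sq_nonneg ((r - u) + (r - v))]
  have p₀₀ := sq_nonneg (r₀₀ - u₀₀)
  have p₁₀ := sq_nonneg (r₁₀ - u₁₀)
  have p₀₁ := sq_nonneg (r₀₁ - u₀₁)
  have p₁₁ := sq_nonneg (r₁₁ - u₁₁)
  by_cases hbottom : r₀₀ = r₁₀
  · subst hbottom
    left; linarith [side r₀₀ u₀₀ u₁₀]
  by_cases hleft : r₀₀ = r₀₁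
  · subst hleft
    right; linarith [side r₀₀ u₀₀ u₀₁]
  by_cases hright : r₁₀ = r₁₁
  · subst hright
    right
    rw [show u₀₀ - u₀₁ = u₁₀ - u₁₁ by linarith]
    linarith [side r₁₀ u₁₀ u₁₁]
  -- The values alternate around the parallelogram, which is incompatible with `hu` unless the
  -- total error is at least `1`.
  left
  apply sq_sub_le_of_alternating _ _ hu <;>
    rcases h₀₀ with rfl | rfl <;> rcases h₁₀ with rfl | rfl <;>
    rcases h₀₁ with rfl | rfl <;> rcases h₁₁ with rfl | rfl <;> norm_num at *

lemma exists_sum_erase_le [Nonempty ι] {α : ι → ℝ} (hα : ∀ i, 0 ≤ α i) {η : ℝ}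
    (h : ∀ A : Finset ι, min (∑ i ∈ A, α i) (∑ i ∈ Aᶜ, α i) ≤ η) :
    ∃ i₀, ∑ i ∈ univ.erase i₀, α i ≤ 3 * η := by
  have hη : 0 ≤ η := by simpa [sum_nonneg fun i _ => hα i] using h ∅
  by_cases hheavy : ∃ i, η < α i
  · obtain ⟨i, hi⟩ := hheavy
    refine ⟨i, ?_⟩
    have hi' := h {i}
    rw [sum_singleton, min_le_iff, or_iff_right hi.not_ge, compl_eq_univ_sdiff,
      sdiff_singleton_eq_erase] at hi'
    linarith
  · push Not at hheavy
    refine ⟨Classical.arbitrary ι, (sum_le_univ_sum_of_nonneg hα).trans ?_⟩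
    by_contra! htotal
    -- Adding light elements one at a time, a light set cannot jump to being the heavy side.
    have light : ∀ B : Finset ι, ∑ i ∈ B, α i ≤ η := fun B => by
      induction B using Finset.induction_on with
      | empty => simpa using hη
      | insert i B hi ih =>
        refine (min_le_iff.mp (h (insert i B))).resolve_right fun hc => ?_
        have hs := sum_add_sum_compl (insert i B) α
        rw [sum_insert hi] at hs
        linarith [hheavy i]
    linarith [light univ]

section BooleanOnCube

variable {F : (ι → Bool) → ℝ}

lemma expect_min_rad_sq_le (hF : IsBoolean F) (a : ℝ) (w : ι → ℝ) (A : Finset ι) :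
    (𝔼 y, min (rad w A y ^ 2) (rad w Aᶜ y ^ 2)) ≤
      6 * 𝔼 y, (F y - (a + rad w univ y)) ^ 2 := by
  set err : (ι → Bool) → ℝ := fun y => (F y - (a + rad w univ y)) ^ 2 with herr
  have hpoint : ∀ y, 4 * min (rad w A y ^ 2) (rad w Aᶜ y ^ 2) ≤
      6 * (err y + err (flipOn A y) + err (flipOn Aᶜ y) + err (flipOn univ y)) := fun y => by
    have hsplit : rad w A y + rad w Aᶜ y = rad w univ y := sum_add_sum_compl A _
    have hpar := min_sq_sub_le_of_add_eq_add (hF y) (hF (flipOn A y)) (hF (flipOn Aᶜ y))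
      (hF (flipOn univ y)) (u₀₀ := a + rad w univ y) (u₁₀ := a + rad w univ (flipOn A y))
      (u₀₁ := a + rad w univ (flipOn Aᶜ y)) (u₁₁ := a + rad w univ (flipOn univ y))
      (by simp only [rad_flipOn]; linarith)
    simp only [rad_flipOn, ← hsplit] at hpar
    simp only [herr, rad_flipOn, ← hsplit]
    refine le_trans (le_of_eq ?_) hpar
    rw [mul_min_of_nonneg _ _ (by norm_num)]
    congr 1 <;> ring
  have := expect_le_expect (s := univ) fun y _ => hpoint y
  simp only [← mul_expect, expect_add_distrib, expect_flipOn] at this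
  linarith

lemma exists_int_sq_sub_le (hF : IsBoolean F) (a : ℝ) (w : ι → ℝ) (i : ι) :
    ∃ m : ℤ, m ^ 2 ≤ 1 ∧ (2 * w i - m) ^ 2 ≤ 4 * 𝔼 y, (F y - (a + rad w univ y)) ^ 2 := by
  set err : (ι → Bool) → ℝ := fun y => F y - (a + rad w univ y) with herr
  obtain ⟨y, -, hy⟩ : ∃ y ∈ univ, 2 * (err y ^ 2 + err (flipOn {i} y) ^ 2) ≤
      4 * 𝔼 y, err y ^ 2 := exists_le_of_expect_le univ_nonempty <| by
    rw [← mul_expect, expect_add_distrib, expect_flipOn {i} fun y => err y ^ 2]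
    linarith
  obtain ⟨d, hd, hdF⟩ := hF.exists_int_eq_sub y (flipOn {i} y)
  have hdiff : 2 * (w i * sgn y i) - d = err (flipOn {i} y) - err y := by
    have hrad : rad w univ (flipOn {i} y) = rad w univ y - 2 * (w i * sgn y i) := by
      rw [rad_flipOn, show rad w {i} y = w i * sgn y i from sum_singleton _ _]
    simp only [herr, hrad, hdF]
    ring
  have hsq : (2 * (w i * sgn y i) - d) ^ 2 ≤ 4 * 𝔼 y, err y ^ 2 := by
    rw [hdiff]
    nlinarith [sq_nonneg (err (flipOn {i} y) + err y)]
  rcases sgn_eq_or y i with hs | hs <;> rw [hs] at hsq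
  · exact ⟨d, hd, by linarith⟩
  · exact ⟨-d, by rwa [neg_sq], by push_cast; linarith⟩

/-- `2 * w i` is the amount by which flipping the `i`-th bit changes the affine function; it is `±1`
for a dictator. -/
theorem cube_fkn [Nonempty ι] (hF : IsBoolean F) (a : ℝ) (w : ι → ℝ) :
    ∃ (i₀ : ι) (m : ℤ), m ^ 2 ≤ 1 ∧
      ∑ i ∈ univ.erase i₀, (2 * w i) ^ 2 + (2 * w i₀ - m) ^ 2 ≤
        436 * 𝔼 y, (F y - (a + rad w univ y)) ^ 2 := by
  obtain ⟨i₀, hi₀⟩ := exists_sum_erase_le (α := fun i => w i ^ 2) (fun i => sq_nonneg _)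
    (η := 36 * 𝔼 y, (F y - (a + rad w univ y)) ^ 2) fun A => by
      linarith [min_sum_sq_le_expect_min w (disjoint_compl_right (a := A)),
        expect_min_rad_sq_le hF a w A]
  obtain ⟨m, hm, hle⟩ := exists_int_sq_sub_le hF a w i₀
  refine ⟨i₀, m, hm, ?_⟩
  simp only [mul_pow, ← mul_sum]
  linarith

end BooleanOnCube

end Cube

section GroupAverage

variable {G X Y : Type*} [Group G] [MulAction G X] [MulAction G Y] [Fintype X] [Fintype Y]
  [MulAction.IsPretransitive G Y] {M : Type*} [AddCommMonoid M] [Module ℚ≥0 M]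

lemma expect_smul_eq_expect [Fintype G] (a : Y) (Φ : Y → M) : (𝔼 g : G, Φ (g • a)) = 𝔼 y, Φ y := by
  have hconst : ∀ y : Y, (𝔼 g : G, Φ (g • y)) = 𝔼 g : G, Φ (g • a) := fun y => by
    obtain ⟨h, rfl⟩ := MulAction.exists_smul_eq G a y
    exact Fintype.expect_equiv (Equiv.mulRight h) _ _ fun g => by simp [mul_smul]
  have : Nonempty Y := ⟨a⟩
  calc (𝔼 g : G, Φ (g • a)) = 𝔼 y : Y, 𝔼 g : G, Φ (g • y) := by
        simp only [hconst, Fintype.expect_const]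
    _ = 𝔼 g : G, 𝔼 y : Y, Φ (g • y) := expect_comm _ _ _
    _ = 𝔼 _g : G, 𝔼 y : Y, Φ y := expect_congr rfl fun g _ =>
        Fintype.expect_equiv (MulAction.toPerm g) _ _ fun _ => rfl
    _ = 𝔼 y, Φ y := Fintype.expect_const _

lemma expect_comp_mulActionHom [Finite G] [Nonempty X] (φ : X →[G] Y) (Φ : Y → M) :
    (𝔼 x, Φ (φ x)) = 𝔼 y, Φ y := by
  have := Fintype.ofFinite G
  calc (𝔼 x, Φ (φ x)) = 𝔼 _g : G, 𝔼 x, Φ (φ x) := (Fintype.expect_const _).symm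
    _ = 𝔼 g : G, 𝔼 x, Φ (φ (g • x)) := expect_congr rfl fun g _ =>
        (Fintype.expect_equiv (MulAction.toPerm g) _ _ fun _ => rfl).symm
    _ = 𝔼 x, 𝔼 g : G, Φ (g • φ x) := by
        rw [expect_comm]
        simp only [map_smul]
    _ = 𝔼 y, Φ y := by simp only [expect_smul_eq_expect, Fintype.expect_const]

end GroupAverage

section RandomPairs

variable {α κ : Type*} [Fintype α] [Fintype κ] [Nonempty (κ × Bool ↪ α)]

/-- The difference of the coefficients of the two members of the `i`-th pair of `t`. -/
def pairDiff (c : α → ℝ) (t : κ × Bool ↪ α) (i : κ) : ℝ := c (t (i, true)) - c (t (i, false))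

lemma sum_embedding_le_pow_mul_expect {r : ℕ} (σ : Fin r ↪ κ × Bool) {Q : (Fin r ↪ α) → ℝ}
    (hQ : ∀ u, 0 ≤ Q u) :
    ∑ u, Q u ≤ (Fintype.card α : ℝ) ^ r * 𝔼 t : κ × Bool ↪ α, Q (σ.trans t) := by
  classical
  have := Equiv.Perm.isMultiplyPretransitive α r
  let φ : (κ × Bool ↪ α) →[Equiv.Perm α] (Fin r ↪ α) := ⟨fun t => σ.trans t, fun _ _ => rfl⟩
  rw [show (𝔼 t : κ × Bool ↪ α, Q (σ.trans t)) = 𝔼 u, Q u from expect_comp_mulActionHom φ Q,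
    ← Fintype.card_mul_expect]
  refine mul_le_mul_of_nonneg_right ?_ (expect_nonneg fun u _ => hQ u)
  have : Fintype.card (Fin r ↪ α) ≤ Fintype.card α ^ r := by
    rw [Fintype.card_embedding_eq, Fintype.card_fin]
    exact Nat.descFactorial_le_pow _ _
  exact_mod_cast this

lemma sum_sum_sub_le_expect_pairDiff (c : α → ℝ) {H : ℝ → ℝ} (hH : ∀ v, 0 ≤ H v) (hH₀ : H 0 = 0)
    (i : κ) :
    ∑ a, ∑ b, H (c a - c b) ≤
      (Fintype.card α : ℝ) ^ 2 * 𝔼 t : κ × Bool ↪ α, H (pairDiff c t i) := by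
  classical
  have hi : ((i, true) : κ × Bool) ≠ (i, false) := by simp
  refine le_trans (le_of_eq ?_) (sum_embedding_le_pow_mul_expect (Function.Embedding.embFinTwo hi)
    (Q := fun u => H (c (u 0) - c (u 1))) fun u => hH _)
  calc ∑ a, ∑ b, H (c a - c b) = ∑ p : α × α, H (c p.1 - c p.2) := (Fintype.sum_prod_type' _).symm
    _ = ∑ p : α × α with p.1 ≠ p.2, H (c p.1 - c p.2) := by
        refine (sum_filter_of_ne fun p _ hp => ?_).symm
        rintro heq
        exact hp (by rw [heq, sub_self, hH₀])
    _ = ∑ p : {p : α × α // p.1 ≠ p.2}, H (c p.1.1 - c p.1.2) :=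
        sum_subtype _ (by simp) _
    _ = ∑ u : Fin 2 ↪ α, H (c (u 0) - c (u 1)) :=
        (Function.Embedding.twoEmbeddingEquiv.sum_comp fun p => H (c p.1.1 - c p.1.2)).symm

lemma card_offDiag_mul_card_offDiag_le {c : α → ℝ} {A B : Finset α}
    (hAB : ∀ a ∈ A, ∀ b ∈ B, 1 ≤ (c a - c b) ^ 2) {i j : κ} (hij : i ≠ j) :
    (#A.offDiag : ℝ) * #B.offDiag ≤ (Fintype.card α : ℝ) ^ 4 *
      𝔼 t : κ × Bool ↪ α, min (pairDiff c t i ^ 2) (pairDiff c t j ^ 2) := by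
  classical
  let σ : Fin 4 ↪ κ × Bool := ⟨![(i, true), (i, false), (j, true), (j, false)], by
    intro x y; fin_cases x <;> fin_cases y <;> simp [hij, hij.symm]⟩
  refine le_trans ?_ (sum_embedding_le_pow_mul_expect σ
    (Q := fun u => min ((c (u 0) - c (u 1)) ^ 2) ((c (u 2) - c (u 3)) ^ 2))
    fun u => le_min (sq_nonneg _) (sq_nonneg _))
  have hcard : #(A.offDiag ×ˢ B.offDiag) ≤
      #{u : Fin 4 ↪ α | (u 0 ∈ A ∧ u 2 ∈ A) ∧ u 1 ∈ B ∧ u 3 ∈ B} := by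
    refine card_le_card_of_surjOn (fun u => ((u 0, u 2), (u 1, u 3))) ?_
    rintro ⟨⟨a, a'⟩, b, b'⟩ h
    simp only [coe_product, Set.mem_prod, mem_coe, mem_offDiag] at h
    obtain ⟨⟨ha, ha', haa'⟩, hb, hb', hbb'⟩ := h
    have hne : ∀ x ∈ A, ∀ y ∈ B, x ≠ y := by
      rintro x hx _ hy rfl
      have := hAB x hx x hy
      norm_num at this
    have hinj : Function.Injective ![a, b, a', b'] := by
      intro x y
      fin_cases x <;> fin_cases y <;>
        simp [haa', haa'.symm, hbb', hbb'.symm, hne a ha b hb, hne a ha b' hb', hne a' ha' b hb,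
          hne a' ha' b' hb', (hne a ha b hb).symm, (hne a ha b' hb').symm, (hne a' ha' b hb).symm,
          (hne a' ha' b' hb').symm]
    exact ⟨⟨_, hinj⟩, mem_filter.mpr ⟨mem_univ _, ⟨ha, ha'⟩, hb, hb'⟩, rfl⟩
  calc (#A.offDiag : ℝ) * #B.offDiag = #(A.offDiag ×ˢ B.offDiag) := by
        rw [card_product, Nat.cast_mul]
    _ ≤ ∑ u : Fin 4 ↪ α with (u 0 ∈ A ∧ u 2 ∈ A) ∧ u 1 ∈ B ∧ u 3 ∈ B, (1 : ℝ) := by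
        rw [sum_const, nsmul_one]
        exact_mod_cast hcard
    _ ≤ ∑ u : Fin 4 ↪ α, min ((c (u 0) - c (u 1)) ^ 2) ((c (u 2) - c (u 3)) ^ 2) := by
        rw [sum_filter]
        refine sum_le_sum fun u _ => ?_
        split_ifs with h
        · exact le_min (hAB _ h.1.1 _ h.2.1) (hAB _ h.1.2 _ h.2.2)
        · exact le_min (sq_nonneg _) (sq_nonneg _)

end RandomPairs

section SliceAverage

variable {n k : ℕ}

instance : MulAction (Equiv.Perm (Fin n)) (Slice n k) :=
  inferInstanceAs (MulAction (Equiv.Perm (Fin n)) (Set.powersetCard (Fin n) k))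

instance : MulAction.IsPretransitive (Equiv.Perm (Fin n)) (Slice n k) :=
  Set.powersetCard.isPretransitive

/-- The embedding `i ↦ (i, y i)`, choosing one member of each of `k` pairs. -/
def pairChoice (y : Fin k → Bool) : Fin k ↪ Fin k × Bool :=
  ⟨fun i => (i, y i), fun _ _ h => congrArg Prod.fst h⟩

/-- The point of the slice which contains exactly one member of each pair of `t`, chosen by `y`. -/
def cubePoint (t : Fin k × Bool ↪ Fin n) (y : Fin k → Bool) : Slice n k :=
  Set.powersetCard.ofFinEmb k (Fin n) ((pairChoice y).trans t)

lemma expect_cubePoint [Nonempty (Fin k × Bool ↪ Fin n)] (y : Fin k → Bool) (Φ : Slice n k → ℝ) :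
    (𝔼 t, Φ (cubePoint t y)) = 𝔼 x, Φ x :=
  let φ : (Fin k × Bool ↪ Fin n) →[Equiv.Perm (Fin n)] Slice n k :=
    ⟨fun t => cubePoint t y, fun g t => map_smul
      (Set.powersetCard.mulActionHom_of_embedding (Equiv.Perm (Fin n)) (Fin n) k) g
      ((pairChoice y).trans t)⟩
  expect_comp_mulActionHom φ Φ

lemma sum_mul_coord (c : Fin n → ℝ) (x : Slice n k) : ∑ i, c i * coord i x = ∑ i ∈ x.1, c i := by
  simp [coord, sum_ite_mem]

lemma affine_cubePoint (c₀ : ℝ) (c : Fin n → ℝ) (t : Fin k × Bool ↪ Fin n) (y : Fin k → Bool) :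
    c₀ + ∑ i, c i * coord i (cubePoint t y) =
      (c₀ + ∑ i, (c (t (i, true)) + c (t (i, false))) / 2)
        + rad (fun i => pairDiff c t i / 2) univ y := by
  rw [sum_mul_coord, cubePoint, Set.powersetCard.val_ofFinEmb, sum_map, rad, add_assoc,
    ← sum_add_distrib]
  refine congrArg (c₀ + ·) (sum_congr rfl fun i _ => ?_)
  change c (t (i, y i)) = _
  simp only [pairDiff, sgn]
  cases y i <;> simp <;> ring

/-- The squared distance between `f` and `l` on the subcube of the slice spanned by the pairs
of `t`. -/
noncomputable def cubeError (f l : Slice n k → ℝ) (t : Fin k × Bool ↪ Fin n) : ℝ :=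
  sqNorm fun y => f (cubePoint t y) - l (cubePoint t y)

lemma expect_cubeError [Nonempty (Fin k × Bool ↪ Fin n)] (f l : Slice n k → ℝ) :
    (𝔼 t, cubeError f l t) = sqNorm fun x => f x - l x := by
  simp only [cubeError, sqNorm]
  rw [expect_comm]
  simp only [expect_cubePoint _ fun x : Slice n k => (f x - l x) ^ 2, Fintype.expect_const]

lemma nonempty_pairs_embedding (h : 2 * k ≤ n) : Nonempty (Fin k × Bool ↪ Fin n) :=
  Function.Embedding.nonempty_of_card_le (by simp; omega)

lemma mul_sum_sum_sub_le (hkn : 2 * k ≤ n) {f l : Slice n k → ℝ} (c : Fin n → ℝ) {H : ℝ → ℝ}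
    (hH : ∀ v, 0 ≤ H v) (hH₀ : H 0 = 0) {A B : ℝ}
    (h : ∀ t, ∑ i, H (pairDiff c t i) ≤ A + B * cubeError f l t) :
    k * ∑ a, ∑ b, H (c a - c b) ≤ (n : ℝ) ^ 2 * (A + B * sqNorm fun x => f x - l x) := by
  have := nonempty_pairs_embedding hkn
  calc k * ∑ a, ∑ b, H (c a - c b) = ∑ _i : Fin k, ∑ a, ∑ b, H (c a - c b) := by simp
    _ ≤ ∑ i : Fin k, (n : ℝ) ^ 2 * 𝔼 t : Fin k × Bool ↪ Fin n, H (pairDiff c t i) :=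
        sum_le_sum fun i _ => by simpa using sum_sum_sub_le_expect_pairDiff c hH hH₀ i
    _ = (n : ℝ) ^ 2 * 𝔼 t : Fin k × Bool ↪ Fin n, ∑ i, H (pairDiff c t i) := by
        rw [← mul_sum, expect_sum_comm]
    _ ≤ (n : ℝ) ^ 2 * 𝔼 t : Fin k × Bool ↪ Fin n, (A + B * cubeError f l t) := by
        gcongr with t
        exact h t
    _ = (n : ℝ) ^ 2 * (A + B * sqNorm fun x => f x - l x) := by
        rw [expect_add_distrib, Fintype.expect_const, ← mul_expect, expect_cubeError]

end SliceAverage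

section Coefficients

variable {n k : ℕ} {f l : Slice n k → ℝ} {c₀ : ℝ} {c : Fin n → ℝ}

lemma exists_pairDiff_le (hk : 0 < k) (hf : IsBoolean f)
    (hl : ∀ x, l x = c₀ + ∑ i, c i * coord i x) (t : Fin k × Bool ↪ Fin n) :
    ∃ (i₀ : Fin k) (m : ℤ), m ^ 2 ≤ 1 ∧
      ∑ i ∈ univ.erase i₀, pairDiff c t i ^ 2 + (pairDiff c t i₀ - m) ^ 2 ≤
        436 * cubeError f l t := by
  have : Nonempty (Fin k) := ⟨⟨0, hk⟩⟩
  have := cube_fkn (F := fun y => f (cubePoint t y)) (fun y => hf _)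
    (c₀ + ∑ i, (c (t (i, true)) + c (t (i, false))) / 2) fun i => pairDiff c t i / 2
  simpa only [cubeError, sqNorm, hl, affine_cubePoint, mul_div_cancel₀ _ (two_ne_zero' ℝ)]
    using this

lemma sum_sq_sub_round_pairDiff_le (hk : 0 < k) (hf : IsBoolean f)
    (hl : ∀ x, l x = c₀ + ∑ i, c i * coord i x) (t : Fin k × Bool ↪ Fin n) :
    ∑ i, (pairDiff c t i - round (pairDiff c t i)) ^ 2 ≤ 436 * cubeError f l t := by
  obtain ⟨i₀, m, -, h⟩ := exists_pairDiff_le hk hf hl t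
  refine le_trans ?_ h
  rw [← sum_erase_add _ _ (mem_univ i₀)]
  refine add_le_add (sum_le_sum fun i _ => sq_le_sq.mpr ?_) (sq_le_sq.mpr (round_le _ _))
  simpa using round_le (pairDiff c t i) 0

lemma sum_sq_pairDiff_le (hk : 0 < k) (hf : IsBoolean f)
    (hl : ∀ x, l x = c₀ + ∑ i, c i * coord i x) (t : Fin k × Bool ↪ Fin n) :
    ∑ i, pairDiff c t i ^ 2 ≤ 2 + 872 * cubeError f l t := by
  obtain ⟨i₀, m, hm, h⟩ := exists_pairDiff_le hk hf hl t
  have hm' : (m : ℝ) ^ 2 ≤ 1 := by exact_mod_cast hm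
  have hs : 0 ≤ ∑ i ∈ univ.erase i₀, pairDiff c t i ^ 2 := sum_nonneg fun i _ => sq_nonneg _
  rw [← sum_erase_add _ _ (mem_univ i₀)]
  nlinarith [sq_nonneg (pairDiff c t i₀ - 2 * m)]

lemma min_sq_pairDiff_le (hk : 0 < k) (hf : IsBoolean f)
    (hl : ∀ x, l x = c₀ + ∑ i, c i * coord i x) (t : Fin k × Bool ↪ Fin n) {i j : Fin k}
    (hij : i ≠ j) :
    min (pairDiff c t i ^ 2) (pairDiff c t j ^ 2) ≤ 436 * cubeError f l t := by
  obtain ⟨i₀, m, -, h⟩ := exists_pairDiff_le hk hf hl t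
  have small : ∀ r ≠ i₀, pairDiff c t r ^ 2 ≤ 436 * cubeError f l t := fun r hr => by
    have := single_le_sum (f := fun i => pairDiff c t i ^ 2) (fun i _ => sq_nonneg _)
      (mem_erase.mpr ⟨hr, mem_univ r⟩)
    linarith [sq_nonneg (pairDiff c t i₀ - m)]
  by_cases hi : i = i₀
  · exact (min_le_right _ _).trans (small j (hi ▸ hij.symm))
  · exact (min_le_left _ _).trans (small i hi)

variable {ε : ℝ}

lemma mul_sum_sum_sq_sub_round_le (hk : 0 < k) (hkn : 2 * k ≤ n) (hf : IsBoolean f)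
    (hl : ∀ x, l x = c₀ + ∑ i, c i * coord i x) (hε : IsClose ε f l) :
    k * ∑ a, ∑ b, (c a - c b - round (c a - c b)) ^ 2 ≤ (n : ℝ) ^ 2 * (436 * ε) := by
  refine (mul_sum_sum_sub_le hkn (f := f) (l := l) (A := 0) (B := 436) c
    (H := fun v => (v - round v) ^ 2) (fun v => sq_nonneg _) (by simp) fun t => ?_).trans ?_
  · simpa using sum_sq_sub_round_pairDiff_le hk hf hl t
  · rw [zero_add]
    gcongr
    exact hε

lemma mul_sum_sum_sq_sub_le (hk : 0 < k) (hkn : 2 * k ≤ n) (hf : IsBoolean f)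
    (hl : ∀ x, l x = c₀ + ∑ i, c i * coord i x) (hε : IsClose ε f l) :
    k * ∑ a, ∑ b, (c a - c b) ^ 2 ≤ (n : ℝ) ^ 2 * (2 + 872 * ε) := by
  refine (mul_sum_sum_sub_le hkn c (H := (· ^ 2)) (fun v => sq_nonneg v) (by simp)
    (sum_sq_pairDiff_le hk hf hl)).trans ?_
  gcongr
  exact hε

variable {A B : Finset (Fin n)}

lemma mul_card_mul_card_le (hk : 0 < k) (hkn : 2 * k ≤ n) (hf : IsBoolean f)
    (hl : ∀ x, l x = c₀ + ∑ i, c i * coord i x) (hε : IsClose ε f l)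
    (hAB : ∀ a ∈ A, ∀ b ∈ B, 1 ≤ (c a - c b) ^ 2) :
    (k : ℝ) * (#A * #B) ≤ (n : ℝ) ^ 2 * (2 + 872 * ε) := by
  refine le_trans ?_ (mul_sum_sum_sq_sub_le hk hkn hf hl hε)
  gcongr
  calc (#A * #B : ℝ) = ∑ _a ∈ A, ∑ _b ∈ B, 1 := by simp
    _ ≤ ∑ a ∈ A, ∑ b ∈ B, (c a - c b) ^ 2 :=
        sum_le_sum fun a ha => sum_le_sum fun b hb => hAB a ha b hb
    _ ≤ ∑ a, ∑ b, (c a - c b) ^ 2 := by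
        refine (sum_le_sum fun a _ => sum_le_univ_sum_of_nonneg fun b => sq_nonneg _).trans ?_
        exact sum_le_univ_sum_of_nonneg fun a => sum_nonneg fun b _ => sq_nonneg _

lemma card_offDiag_mul_card_offDiag_le_of_isClose (hk : 2 ≤ k) (hkn : 2 * k ≤ n)
    (hf : IsBoolean f) (hl : ∀ x, l x = c₀ + ∑ i, c i * coord i x) (hε : IsClose ε f l)
    (hAB : ∀ a ∈ A, ∀ b ∈ B, 1 ≤ (c a - c b) ^ 2) :
    (#A.offDiag : ℝ) * #B.offDiag ≤ (n : ℝ) ^ 4 * (436 * ε) := by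
  have := nonempty_pairs_embedding hkn
  have hij : (⟨0, by omega⟩ : Fin k) ≠ ⟨1, by omega⟩ := by simp
  refine (card_offDiag_mul_card_offDiag_le hAB hij).trans ?_
  rw [Fintype.card_fin]
  gcongr
  refine (expect_le_expect fun t _ => min_sq_pairDiff_le (by omega) hf hl t hij).trans ?_
  rw [← mul_expect, expect_cubeError]
  gcongr
  exact hε

end Coefficients

section Moments

variable {n k : ℕ}

lemma card_slice : Fintype.card (Slice n k) = n.choose k := by
  rw [Fintype.card_finset_len, Fintype.card_fin]

lemma slice_nonempty (h : k ≤ n) : Nonempty (Slice n k) := by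
  rw [← Fintype.card_pos_iff, card_slice]
  exact Nat.choose_pos h

lemma card_inter_eq {S T : Finset (Fin n)} (hT : T ⊆ S) (hk : #T ≤ k) :
    #{x : Slice n k | x.1 ∩ S = T} = (n - #S).choose (k - #T) := by
  have hcompl : #Sᶜ = n - #S := by rw [card_compl, Fintype.card_fin]
  rw [← hcompl, ← card_powersetCard]
  refine card_bij (fun x _ => x.1 \ S) ?_ ?_ ?_
  · intro x hx
    refine mem_powersetCard.mpr ⟨fun i hi => mem_compl.mpr (mem_sdiff.mp hi).2, ?_⟩
    have := card_sdiff_add_card_inter x.1 S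
    rw [(mem_filter.mp hx).2, x.2] at this
    omega
  · intro x hx y hy hxy
    refine Subtype.ext ?_
    rw [← sdiff_union_inter x.1 S, ← sdiff_union_inter y.1 S, (mem_filter.mp hx).2,
      (mem_filter.mp hy).2, hxy]
  · intro y hy
    obtain ⟨hyS, hyc⟩ := mem_powersetCard.mp hy
    have hd : Disjoint y S := disjoint_left.mpr fun i hi => mem_compl.mp (hyS hi)
    have hdT : Disjoint y T := disjoint_of_subset_right hT hd
    refine ⟨⟨y ∪ T, ?_⟩, mem_filter.mpr ⟨mem_univ _, ?_⟩, ?_⟩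
    · rw [card_union_of_disjoint hdT, hyc]
      omega
    · rw [union_inter_distrib_right, disjoint_iff_inter_eq_empty.mp hd, empty_union,
        inter_eq_left.mpr hT]
    · rw [union_sdiff_distrib, sdiff_eq_self_of_disjoint hd, sdiff_eq_empty_iff_subset.mpr hT,
        union_empty]

lemma expect_inter_eq {S T : Finset (Fin n)} (hT : T ⊆ S) (hk : #T ≤ k) :
    (𝔼 x : Slice n k, if x.1 ∩ S = T then (1 : ℝ) else 0) =
      (n - #S).choose (k - #T) / n.choose k := by
  rw [Fintype.expect_eq_sum_div_card, card_slice, sum_boole, card_inter_eq hT hk]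

lemma expect_subset (hkn : k ≤ n) (T : Finset (Fin n)) :
    (𝔼 x : Slice n k, if T ⊆ x.1 then (1 : ℝ) else 0) = k.choose #T / n.choose #T := by
  rcases le_or_gt #T k with hT | hT
  · have hpos : ∀ {m}, m ≤ n → (0 : ℝ) < n.choose m := fun h => by exact_mod_cast Nat.choose_pos h
    have := expect_inter_eq (subset_refl T) hT
    simp only [inter_eq_right] at this
    rw [this, div_eq_div_iff (hpos hkn).ne' (hpos (hT.trans hkn)).ne', mul_comm,
      mul_comm (k.choose _ : ℝ)]
    exact_mod_cast (Nat.choose_mul hT).symm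
  · have : ∀ x : Slice n k, ¬T ⊆ x.1 := fun x h => by
      have := card_le_card h
      rw [x.2] at this
      omega
    simp [this, Nat.choose_eq_zero_of_lt hT]

lemma expect_coord (hkn : k ≤ n) (i : Fin n) : (𝔼 x : Slice n k, coord i x) = k / n := by
  simpa [coord] using expect_subset hkn {i}

lemma coord_mul_coord_self (i : Fin n) (x : Slice n k) : coord i x * coord i x = coord i x := by
  unfold coord
  split_ifs <;> norm_num

lemma expect_coord_mul_coord (hkn : k ≤ n) {i j : Fin n} (hij : i ≠ j) :
    (𝔼 x : Slice n k, coord i x * coord j x) = k.choose 2 / n.choose 2 := by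
  rw [← card_pair hij, ← expect_subset hkn]
  refine expect_congr rfl fun x _ => ?_
  simp only [coord, insert_subset_iff, singleton_subset_iff, ite_zero_mul_ite_zero, mul_one]

lemma choose_two_div_le (hkn : k ≤ n) : (k.choose 2 : ℝ) / n.choose 2 ≤ (k / n : ℝ) ^ 2 := by
  have hkn' : (k : ℝ) ≤ n := by exact_mod_cast hkn
  rcases le_or_gt n 1 with hn | hn
  · rw [Nat.choose_eq_zero_of_lt (by omega : n < 2), Nat.cast_zero, div_zero]
    positivity
  have hn' : (1 : ℝ) < n := by exact_mod_cast hn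
  rw [Nat.cast_choose_two, Nat.cast_choose_two, div_div_div_cancel_right₀ two_ne_zero, div_pow,
    div_le_div_iff₀ (by nlinarith) (by positivity)]
  nlinarith [mul_nonneg (mul_nonneg k.cast_nonneg n.cast_nonneg) (sub_nonneg.mpr hkn')]

variable (δ : Fin n → ℝ)

lemma expect_linear (hkn : k ≤ n) :
    (𝔼 x : Slice n k, ∑ i, δ i * coord i x) = k / n * ∑ i, δ i := by
  simp only [expect_sum_comm, ← mul_expect, expect_coord hkn, ← sum_mul, mul_comm]

lemma expect_linear_sq (hkn : k ≤ n) :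
    (𝔼 x : Slice n k, (∑ i, δ i * coord i x) ^ 2) =
      k.choose 2 / n.choose 2 * (∑ i, δ i) ^ 2
        + (k / n - k.choose 2 / n.choose 2) * ∑ i, δ i ^ 2 := by
  have hE : ∀ i j, (𝔼 x : Slice n k, coord i x * coord j x) =
      k.choose 2 / n.choose 2 + if i = j then (k / n - k.choose 2 / n.choose 2 : ℝ) else 0 := by
    intro i j
    split_ifs with h
    · simp only [h, coord_mul_coord_self, expect_coord hkn, add_sub_cancel]
    · rw [expect_coord_mul_coord hkn h, add_zero]
  calc (𝔼 x : Slice n k, (∑ i, δ i * coord i x) ^ 2)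
      = ∑ i, ∑ j, δ i * δ j * 𝔼 x : Slice n k, coord i x * coord j x := by
        simp only [sq, sum_mul_sum, expect_sum_comm, mul_expect]
        exact sum_congr rfl fun i _ => sum_congr rfl fun j _ =>
          expect_congr rfl fun x _ => by ring
    _ = _ := by
        simp only [hE, mul_add, sum_add_distrib, mul_ite, mul_zero, sum_ite_eq, mem_univ, if_true,
          ← sum_mul, sq, sum_mul_sum]
        ring

lemma sqNorm_linear_sub_mean_le (hkn : k ≤ n) :
    sqNorm (fun x : Slice n k => ∑ i, δ i * coord i x - k / n * ∑ i, δ i) ≤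
      k / n * ∑ i, δ i ^ 2 := by
  have := slice_nonempty hkn
  set μ : ℝ := k / n * ∑ i, δ i
  have variance : sqNorm (fun x : Slice n k => ∑ i, δ i * coord i x - μ) =
      (𝔼 x : Slice n k, (∑ i, δ i * coord i x) ^ 2) - μ ^ 2 := by
    simp only [sqNorm, sub_sq, expect_add_distrib, expect_sub_distrib, ← expect_mul, ← mul_expect,
      expect_linear δ hkn, Fintype.expect_const]
    ring
  have hq : (0 : ℝ) ≤ k.choose 2 / n.choose 2 := by positivity
  have hs : 0 ≤ ∑ i, δ i ^ 2 := sum_nonneg fun i _ => sq_nonneg _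
  rw [variance, expect_linear_sq δ hkn]
  nlinarith [mul_nonneg (sub_nonneg.mpr (choose_two_div_le hkn)) (sq_nonneg (∑ i, δ i)),
    mul_nonneg hq hs]

end Moments

section Rounding

variable {n k : ℕ}

lemma exists_mul_sum_le {α : Type*} [Fintype α] [Nonempty α] (Φ : α → α → ℝ) {K B : ℝ}
    (h : K * ∑ a, ∑ b, Φ a b ≤ (Fintype.card α : ℝ) ^ 2 * B) :
    ∃ a, K * ∑ b, Φ a b ≤ Fintype.card α * B := by
  obtain ⟨a, -, ha⟩ := exists_le_of_sum_le (s := univ) (f := fun a => K * ∑ b, Φ a b)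
    (g := fun _ => Fintype.card α * B) univ_nonempty <| by
      rw [← mul_sum, sum_const, card_univ, nsmul_eq_mul, ← mul_assoc, ← sq]
      exact h
  exact ⟨a, ha⟩

lemma sum_sub_const_mul_coord (c : Fin n → ℝ) (a : ℝ) (x : Slice n k) :
    ∑ i, (c i - a) * coord i x = ∑ i, c i * coord i x - a * k := by
  simp only [sub_mul, sum_sub_distrib, sum_mul_coord, sum_const, x.2, nsmul_eq_mul, mul_comm]

lemma abs_sub_round_le_two_mul (u : ℝ) (m : ℤ) : |(m : ℝ) - round u| ≤ 2 * |m - u| := by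
  have hround := round_le u m
  rw [abs_sub_comm u m] at hround
  linarith [abs_sub_le (m : ℝ) u (round u)]

lemma IsBoolean.exists_int_eq_sub_sum {f : Slice n k → ℝ} (hf : IsBoolean f) (e : Fin n → ℤ)
    (x : Slice n k) : ∃ m : ℤ, (m : ℝ) = f x - ∑ i, e i * coord i x := by
  rw [sum_mul_coord]
  rcases hf x with h | h <;> rw [h]
  · exact ⟨0 - ∑ i ∈ x.1, e i, by push_cast; rfl⟩
  · exact ⟨1 - ∑ i ∈ x.1, e i, by push_cast; rfl⟩

lemma isClose_round_affine {f : Slice n k → ℝ} (hkn : k ≤ n) (hf : IsBoolean f) (u : ℝ)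
    (e : Fin n → ℤ) (δ : Fin n → ℝ) {ε η : ℝ}
    (hε : IsClose ε f fun x =>
      u + ∑ i, e i * coord i x + (∑ i, δ i * coord i x - k / n * ∑ i, δ i))
    (hη : k / n * ∑ i, δ i ^ 2 ≤ η) :
    IsClose (8 * (ε + η)) f fun x => round u + ∑ i, e i * coord i x := by
  set Z : Slice n k → ℝ := fun x => ∑ i, δ i * coord i x - k / n * ∑ i, δ i
  have hZ : (𝔼 x, Z x ^ 2) ≤ η := (sqNorm_linear_sub_mean_le δ hkn).trans hη
  have pointwise : ∀ x, (f x - (round u + ∑ i, e i * coord i x)) ^ 2 ≤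
      8 * ((f x - (u + ∑ i, e i * coord i x + Z x)) ^ 2 + Z x ^ 2) := fun x => by
    obtain ⟨m, hm⟩ := hf.exists_int_eq_sub_sum e x
    have hround := pow_le_pow_left₀ (abs_nonneg _) (abs_sub_round_le_two_mul u m) 2
    rw [mul_pow, sq_abs, sq_abs, hm] at hround
    nlinarith [sq_nonneg (f x - (u + ∑ i, e i * coord i x + Z x) - Z x)]
  calc sqNorm (fun x => f x - (round u + ∑ i, e i * coord i x))
      ≤ 𝔼 x, 8 * ((f x - (u + ∑ i, e i * coord i x + Z x)) ^ 2 + Z x ^ 2) :=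
        expect_le_expect fun x _ => pointwise x
    _ ≤ 8 * (ε + η) := by
        rw [← mul_expect, expect_add_distrib]
        gcongr
        exact hε

theorem exists_int_affine_isClose {f l : Slice n k → ℝ} {ε : ℝ} (hk : 0 < k) (hkn : 2 * k ≤ n)
    (hf : IsBoolean f) (hl : IsAffine l) (hε : IsClose ε f l) :
    ∃ (b : ℤ) (e : Fin n → ℤ),
      IsClose (3496 * ε) f fun x => b + ∑ i, (e i : ℝ) * coord i x := by
  obtain ⟨c₀, c, hl⟩ := hl
  have : Nonempty (Fin n) := ⟨⟨0, by omega⟩⟩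
  have hn : (0 : ℝ) < n := by exact_mod_cast (by omega : 0 < n)
  obtain ⟨a, ha⟩ := exists_mul_sum_le (fun a b => (c a - c b - round (c a - c b)) ^ 2)
    (K := k) (B := 436 * ε) (by simpa using mul_sum_sum_sq_sub_round_le hk hkn hf hl hε)
  rw [Fintype.card_fin] at ha
  set e : Fin n → ℤ := fun i => -round (c a - c i)
  set δ : Fin n → ℝ := fun i => c i - c a - e i
  set u : ℝ := c₀ + c a * k + k / n * ∑ i, δ i
  have hδ : k / n * ∑ i, δ i ^ 2 ≤ 436 * ε := by
    have hδa : ∀ i, δ i ^ 2 = (c a - c i - round (c a - c i)) ^ 2 := fun i => by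
      simp only [δ, e, Int.cast_neg]
      ring
    simpa only [div_mul_eq_mul_div, div_le_iff₀' hn, hδa] using ha
  have hl' : l = fun x =>
      u + ∑ i, (e i : ℝ) * coord i x + (∑ i, δ i * coord i x - k / n * ∑ i, δ i) := by
    funext x
    have hc : ∑ i, (e i : ℝ) * coord i x + ∑ i, δ i * coord i x =
        ∑ i, c i * coord i x - c a * k := by
      rw [← sum_add_distrib, ← sum_sub_const_mul_coord]
      exact sum_congr rfl fun i _ => by simp only [δ]; ring
    rw [hl]
    linear_combination -hc
  refine ⟨round u, e, ?_⟩
  rw [hl'] at hε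
  convert isClose_round_affine (by omega) hf u e δ hε hδ using 1
  ring

end Rounding

section Support

lemma exists_median {α β : Type*} [Fintype α] [Nonempty α] [LinearOrder β] (e : α → β) :
    ∃ m, Fintype.card α ≤ 2 * #{i | e i ≤ m} ∧ Fintype.card α ≤ 2 * #{i | m ≤ e i} := by
  let upper : Finset α := {i | Fintype.card α ≤ 2 * #{j | e j ≤ e i}}
  have hupper : upper.Nonempty := by
    obtain ⟨i, hi⟩ := Finite.exists_max e
    refine ⟨i, mem_filter.mpr ⟨mem_univ _, ?_⟩⟩
    rw [filter_true_of_mem fun j _ => hi j, card_univ]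
    omega
  obtain ⟨i, hi, hmin⟩ := exists_min_image upper e hupper
  refine ⟨e i, (mem_filter.mp hi).2, ?_⟩
  have hlt : 2 * #{j | e j < e i} ≤ Fintype.card α := by
    rcases eq_empty_or_nonempty ({j | e j < e i} : Finset α) with h | h
    · rw [h]
      simp
    obtain ⟨j, hj, hmax⟩ := exists_max_image _ e h
    have hji := (mem_filter.mp hj).2
    have hj_upper : j ∉ upper := fun hju => (hmin j hju).not_gt hji
    have hle : #{l | e l < e i} ≤ #{l | e l ≤ e j} := card_le_card fun l hl =>
      mem_filter.mpr ⟨mem_univ _, hmax l hl⟩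
    simp only [upper, mem_filter, mem_univ, true_and, not_le] at hj_upper
    omega
  have hcompl := card_filter_add_card_filter_not (s := univ) fun j => e j < e i
  simp only [not_lt, card_univ] at hcompl
  omega

variable {n k : ℕ} {f l : Slice n k → ℝ} {c₀ : ℝ} {c : Fin n → ℝ} {η : ℝ} {F N : Finset (Fin n)}

lemma mul_card_le_of_separated (hk : 0 < k) (hkn : 2 * k ≤ n) (hf : IsBoolean f)
    (hl : ∀ x, l x = c₀ + ∑ i, c i * coord i x) (hη : IsClose η f l) (hsmall : η ≤ 1 / 2 ^ 18)
    (hN : n ≤ 2 * #N) (hFN : ∀ a ∈ F, ∀ b ∈ N, 1 ≤ (c a - c b) ^ 2) : k * #F ≤ 5 * n := by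
  have hn : (0 : ℝ) < n := by exact_mod_cast (by omega : 0 < n)
  have hN' : (n : ℝ) ≤ 2 * #N := by exact_mod_cast hN
  have hF := mul_card_mul_card_le hk hkn hf hl hη hFN
  have : (k * #F : ℝ) * n ≤ 5 * n * n := by
    nlinarith [mul_le_mul_of_nonneg_left hN' (by positivity : (0 : ℝ) ≤ k * #F)]
  exact_mod_cast le_of_mul_le_mul_right this hn

lemma sq_card_le_two_mul_card_offDiag {α : Type*} {A : Finset α} (hA : 2 ≤ #A) :
    #A ^ 2 ≤ 2 * #A.offDiag := by
  rw [offDiag_card, sq, Nat.mul_sub]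
  have := Nat.mul_le_mul_right #A hA
  omega

lemma card_le_of_separated (hk : 2 ≤ k) (hkn : 2 * k ≤ n) (hf : IsBoolean f)
    (hl : ∀ x, l x = c₀ + ∑ i, c i * coord i x) (hη : IsClose η f l) (hsmall : η ≤ 1 / 2 ^ 18)
    (hN : n ≤ 2 * #N) (hFN : ∀ a ∈ F, ∀ b ∈ N, 1 ≤ (c a - c b) ^ 2) :
    #F ≤ 1 ∨ 6 * #F ≤ n := by
  refine or_iff_not_imp_left.mpr fun hF => ?_
  have hn : (0 : ℝ) < n := by exact_mod_cast (by omega : 0 < n)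
  have hF' : (#F ^ 2 : ℝ) ≤ 2 * #F.offDiag := by
    exact_mod_cast sq_card_le_two_mul_card_offDiag (by omega : 2 ≤ #F)
  have hN' : (n ^ 2 : ℝ) ≤ 8 * #N.offDiag := by
    have := sq_card_le_two_mul_card_offDiag (by omega : 2 ≤ #N)
    exact_mod_cast (by nlinarith : n ^ 2 ≤ 8 * #N.offDiag)
  have hFN' := card_offDiag_mul_card_offDiag_le_of_isClose hk hkn hf hl hη hFN
  have : (6 * #F : ℝ) ^ 2 * n ^ 2 ≤ n ^ 2 * n ^ 2 := by
    have := mul_le_mul hF' hN' (by positivity) (by positivity)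
    have : (n : ℝ) ^ 4 * η ≤ n ^ 4 * (1 / 2 ^ 18) := by gcongr
    nlinarith [(by positivity : (0 : ℝ) ≤ n ^ 4)]
  have := le_of_sq_le_sq (le_of_mul_le_mul_right this (by positivity)) hn.le
  exact_mod_cast this

/-- The set of coordinates on which an integral linear function depends. -/
def supp (e : Fin n → ℤ) : Finset (Fin n) := {i | e i ≠ 0}

lemma card_supp (e : Fin n → ℤ) : #(supp e) = #{i | 0 < e i} + #{i | e i < 0} := by
  rw [← card_union_of_disjoint (disjoint_filter.mpr fun i _ => not_lt_of_gt), ← filter_or]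
  exact congrArg card (filter_congr fun i _ => by rw [ne_iff_lt_or_gt, or_comm])

/-- Shifting the coefficients by their median leaves at least half of them nonpositive and at
least half of them nonnegative. -/
theorem exists_sparse_int_affine_isClose {ε : ℝ} (hk : 2 ≤ k) (hkn : 2 * k ≤ n)
    (hf : IsBoolean f) (hl : IsAffine l) (hε : IsClose ε f l) (hsmall : 3496 * ε ≤ 1 / 2 ^ 18) :
    ∃ (b : ℤ) (e : Fin n → ℤ), 3 * #(supp e) ≤ n + 2 ∧ k * #(supp e) ≤ 10 * n ∧
      IsClose (3496 * ε) f fun x => b + ∑ i, (e i : ℝ) * coord i x := by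
  have : Nonempty (Fin n) := ⟨⟨0, by omega⟩⟩
  obtain ⟨b, e, hbe⟩ := exists_int_affine_isClose (by omega) hkn hf hl hε
  obtain ⟨m, hle, hge⟩ := exists_median e
  rw [Fintype.card_fin] at hle hge
  have separated : ∀ i j, e i ≠ e j → 1 ≤ ((e i : ℝ) - e j) ^ 2 := fun i j h => by
    exact_mod_cast one_le_sq_intCast (sub_ne_zero.mpr h)
  have hpos : ∀ i ∈ ({i | m < e i} : Finset (Fin n)), ∀ j ∈ ({j | e j ≤ m} : Finset (Fin n)),
      1 ≤ ((e i : ℝ) - e j) ^ 2 := fun i hi j hj =>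
    separated i j ((mem_filter.mp hj).2.trans_lt (mem_filter.mp hi).2).ne'
  have hneg : ∀ i ∈ ({i | e i < m} : Finset (Fin n)), ∀ j ∈ ({j | m ≤ e j} : Finset (Fin n)),
      1 ≤ ((e i : ℝ) - e j) ^ 2 := fun i hi j hj =>
    separated i j ((mem_filter.mp hi).2.trans_le (mem_filter.mp hj).2).ne
  refine ⟨b + m * k, fun i => e i - m, ?_, ?_, ?_⟩
  · have := card_le_of_separated hk hkn hf (fun _ => rfl) hbe hsmall hle hpos
    have := card_le_of_separated hk hkn hf (fun _ => rfl) hbe hsmall hge hneg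
    simp only [card_supp, sub_pos, sub_neg]
    omega
  · have := mul_card_le_of_separated (by omega) hkn hf (fun _ => rfl) hbe hsmall hle hpos
    have := mul_card_le_of_separated (by omega) hkn hf (fun _ => rfl) hbe hsmall hge hneg
    simp only [card_supp, sub_pos, sub_neg, mul_add]
    omega
  · convert hbe using 2 with x
    push_cast
    rw [sum_sub_const_mul_coord]
    ring

end Support

section Avoidance

lemma exp_neg_three_mul_le_one_sub {v : ℝ} (h₀ : 0 ≤ v) (h₁ : 3 * v ≤ 2) :
    Real.exp (-(3 * v)) ≤ 1 - v := by
  have hpos : 0 < 1 + 3 * v := by positivity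
  calc Real.exp (-(3 * v)) ≤ (1 + 3 * v)⁻¹ := by
        rw [Real.exp_neg]
        exact inv_anti₀ hpos (by linarith [Real.add_one_le_exp (3 * v)])
    _ ≤ 1 - v := by
        rw [inv_le_iff_one_le_mul₀ hpos]
        nlinarith

variable {n k s : ℕ}

lemma exp_mul_sub_le {m : ℕ} (hm : 2 * m + 2 ≤ n) (hs : 3 * s ≤ n + 2) :
    Real.exp (-(6 * s / n)) * (n - m : ℕ) ≤ (n - s - m : ℕ) := by
  have hn : (0 : ℝ) < n := by exact_mod_cast (by omega : 0 < n)
  have hm' : (n : ℝ) + 2 ≤ 2 * (n - m) := by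
    have : (2 * m + 2 : ℝ) ≤ n := by exact_mod_cast hm
    linarith
  have hs' : (3 * s : ℝ) ≤ n + 2 := by exact_mod_cast hs
  push_cast [Nat.cast_sub (by omega : m ≤ n - s), Nat.cast_sub (by omega : s ≤ n),
    Nat.cast_sub (by omega : m ≤ n)]
  set r : ℝ := n - m
  have hr : 0 < r := by linarith
  calc Real.exp (-(6 * s / n)) * r ≤ Real.exp (-(3 * (s / r))) * r := by
        gcongr
        rw [mul_div_assoc', div_le_div_iff₀ hr hn]
        nlinarith [s.cast_nonneg (α := ℝ)]
    _ ≤ (1 - s / r) * r := by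
        gcongr
        refine exp_neg_three_mul_le_one_sub (by positivity) ?_
        rw [mul_div_assoc', div_le_iff₀ hr]
        linarith
    _ = n - s - m := by
        rw [sub_mul, one_mul, div_mul_cancel₀ _ hr.ne']
        ring

lemma exp_mul_choose_le (hkn : 2 * k ≤ n) (hs : 3 * s ≤ n + 2) :
    Real.exp (-(6 * k * s / n)) * n.choose k ≤ (n - s).choose k := by
  have descFactorial_le : ∀ m ≤ k,
      Real.exp (-(6 * s / n)) ^ m * n.descFactorial m ≤ (n - s).descFactorial m := by
    intro m
    induction m with
    | zero => simp
    | succ m ih =>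
      intro hm
      simp only [Nat.descFactorial_succ, Nat.cast_mul, pow_succ]
      calc Real.exp (-(6 * s / n)) ^ m * Real.exp (-(6 * s / n)) *
            ((n - m : ℕ) * n.descFactorial m)
          = (Real.exp (-(6 * s / n)) * (n - m : ℕ)) *
              (Real.exp (-(6 * s / n)) ^ m * n.descFactorial m) := by ring
        _ ≤ (n - s - m : ℕ) * (n - s).descFactorial m :=
            mul_le_mul (exp_mul_sub_le (by omega) hs) (ih (by omega)) (by positivity)
              (by positivity)
  have := descFactorial_le k le_rfl
  rw [← Real.exp_nat_mul, show (k : ℝ) * -(6 * s / n) = -(6 * k * s / n) by ring,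
    Nat.descFactorial_eq_factorial_mul_choose, Nat.descFactorial_eq_factorial_mul_choose,
    Nat.cast_mul, Nat.cast_mul, mul_left_comm] at this
  exact le_of_mul_le_mul_left this (by positivity)

lemma exp_mul_expect_subset_le {S T : Finset (Fin n)} (hkn : 2 * k ≤ n) (hS : 3 * #S ≤ n + 2)
    (hT : T ⊆ S) :
    Real.exp (-(6 * k * #S / n)) * (𝔼 x : Slice n k, if T ⊆ x.1 then (1 : ℝ) else 0) ≤
      𝔼 x : Slice n k, if x.1 ∩ S = T then (1 : ℝ) else 0 := by
  rcases le_or_gt #T k with hTk | hTk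
  · have hsub : (𝔼 x : Slice n k, if T ⊆ x.1 then (1 : ℝ) else 0) =
        (n - #T).choose (k - #T) / n.choose k := by
      simpa only [inter_eq_right] using expect_inter_eq (subset_refl T) hTk
    rw [hsub, expect_inter_eq hT hTk, ← mul_div_assoc]
    gcongr
    calc Real.exp (-(6 * k * #S / n)) * (n - #T).choose (k - #T)
        ≤ Real.exp (-(6 * (k - #T : ℕ) * #S / n)) * n.choose (k - #T) := by
          gcongr <;> omega
      _ ≤ (n - #S).choose (k - #T) := exp_mul_choose_le (by omega) hS
  · rw [expect_subset (by omega), Nat.choose_eq_zero_of_lt hTk, Nat.cast_zero, zero_div, mul_zero]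
    exact expect_nonneg fun x _ => by split_ifs <;> norm_num

end Avoidance

section MaxCoord

variable {n k : ℕ}

lemma maxCoord_eq_ite (S : Finset (Fin n)) (x : Slice n k) :
    maxCoord S x = if (x.1 ∩ S).Nonempty then 1 else 0 := by
  unfold maxCoord
  induction S using Finset.induction_on with
  | empty => simp
  | insert i S hi ih =>
    rw [fold_insert hi, ih]
    by_cases h : i ∈ x.1
    · rw [inter_insert_of_mem h, if_pos (insert_nonempty _ _), coord, if_pos h]
      split_ifs <;> norm_num
    · rw [inter_insert_of_notMem h, coord, if_neg h]
      split_ifs <;> norm_num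

lemma isBoolean_maxCoord (S : Finset (Fin n)) : IsBoolean (maxCoord (k := k) S) := fun x => by
  rw [maxCoord_eq_ite]
  split_ifs <;> simp

end MaxCoord

section BadTraces

variable {n k : ℕ}

/-- The traces on `supp e` of those points at which the integral affine function with constant
term `b` and coefficients `e` takes a value other than `0` and `1`. -/
def badTraces (b : ℤ) (e : Fin n → ℤ) : Finset (Finset (Fin n)) :=
  {T ∈ (supp e).powerset | b + ∑ i ∈ T, e i ≠ 0 ∧ b + ∑ i ∈ T, e i ≠ 1}

/-- The set of coordinates with coefficient `1`. -/
def unitSet (e : Fin n → ℤ) : Finset (Fin n) := {i | e i = 1}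

lemma mem_badTraces {b : ℤ} {e : Fin n → ℤ} {T : Finset (Fin n)} :
    T ∈ badTraces b e ↔ T ⊆ supp e ∧ b + ∑ i ∈ T, e i ≠ 0 ∧ b + ∑ i ∈ T, e i ≠ 1 := by
  rw [badTraces, mem_filter, mem_powerset]

lemma unitSet_subset_supp (e : Fin n → ℤ) : unitSet e ⊆ supp e := fun i hi => by
  simp_all [unitSet, supp]

lemma sum_eq_card_of_subset_unitSet {e : Fin n → ℤ} {T : Finset (Fin n)} (hT : T ⊆ unitSet e) :
    ∑ i ∈ T, e i = #T := by
  rw [sum_congr rfl fun i hi => (mem_filter.mp (hT hi)).2]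
  simp

lemma affine_eq_sum_inter_supp (b : ℤ) (e : Fin n → ℤ) (x : Slice n k) :
    b + ∑ i, (e i : ℝ) * coord i x = (b + ∑ i ∈ x.1 ∩ supp e, e i : ℤ) := by
  rw [sum_mul_coord, supp, inter_filter, inter_univ, sum_filter_ne_zero]
  push_cast
  rfl

lemma sum_badTraces_le {f : Slice n k → ℝ} {b : ℤ} {e : Fin n → ℤ} {η : ℝ} (hkn : 2 * k ≤ n)
    (hs : 3 * #(supp e) ≤ n + 2) (hf : IsBoolean f)
    (hη : IsClose η f fun x => b + ∑ i, (e i : ℝ) * coord i x) :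
    Real.exp (-(6 * k * #(supp e) / n)) *
      ∑ T ∈ badTraces b e, (𝔼 x : Slice n k, if T ⊆ x.1 then (1 : ℝ) else 0) ≤ η := by
  have pointwise : ∀ x : Slice n k,
      (∑ T ∈ badTraces b e, if x.1 ∩ supp e = T then (1 : ℝ) else 0) ≤
        (f x - (b + ∑ i, (e i : ℝ) * coord i x)) ^ 2 := fun x => by
    rw [sum_ite_eq]
    split_ifs with h
    · rw [affine_eq_sum_inter_supp]
      exact one_le_sq_sub_intCast (hf x) (mem_badTraces.mp h).2.1 (mem_badTraces.mp h).2.2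
    · exact sq_nonneg _
  calc _ ≤ ∑ T ∈ badTraces b e, 𝔼 x : Slice n k, if x.1 ∩ supp e = T then (1 : ℝ) else 0 := by
        rw [mul_sum]
        exact sum_le_sum fun T hT => exp_mul_expect_subset_le hkn hs (mem_badTraces.mp hT).1
    _ = 𝔼 x : Slice n k, ∑ T ∈ badTraces b e, if x.1 ∩ supp e = T then (1 : ℝ) else 0 :=
        (expect_sum_comm _ _ _).symm
    _ ≤ η := (expect_le_expect fun x _ => pointwise x).trans hη

lemma one_le_sum_badTraces {b : ℤ} (hkn : k ≤ n) (e : Fin n → ℤ) (h₀ : b ≠ 0) (h₁ : b ≠ 1) :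
    1 ≤ ∑ T ∈ badTraces b e, (𝔼 x : Slice n k, if T ⊆ x.1 then (1 : ℝ) else 0) := by
  have hmem : ∅ ∈ badTraces b e := mem_badTraces.mpr ⟨empty_subset _, by simpa, by simpa⟩
  simp only [expect_subset hkn]
  refine le_trans ?_ (single_le_sum (fun T _ => by positivity) hmem)
  simp

lemma linear_eq_maxCoord {e : Fin n → ℤ} {x : Slice n k} (h : ∀ T ∈ badTraces 0 e, ¬T ⊆ x.1) :
    ∑ i, (e i : ℝ) * coord i x = maxCoord (unitSet e) x := by
  have hunit : x.1 ∩ supp e ⊆ unitSet e := fun i hi => by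
    obtain ⟨hix, hie⟩ := mem_inter.mp hi
    by_contra hne
    have hzero : e i ≠ 0 := (mem_filter.mp hie).2
    have hone : e i ≠ 1 := fun hi => hne (mem_filter.mpr ⟨mem_univ i, hi⟩)
    exact h {i} (mem_badTraces.mpr ⟨singleton_subset_iff.mpr hie, by simpa, by simpa⟩)
      (singleton_subset_iff.mpr hix)
  have hinter : x.1 ∩ supp e = x.1 ∩ unitSet e :=
    (subset_inter inter_subset_left hunit).antisymm
      (inter_subset_inter_left (unitSet_subset_supp e))
  have hsum : ∑ i ∈ x.1 ∩ unitSet e, e i = #(x.1 ∩ unitSet e) :=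
    sum_eq_card_of_subset_unitSet inter_subset_right
  have hcard : #(x.1 ∩ unitSet e) = 0 ∨ #(x.1 ∩ unitSet e) = 1 := by
    by_contra! hne
    refine h (x.1 ∩ unitSet e) (mem_badTraces.mpr ?_) inter_subset_left
    rw [hsum]
    exact ⟨hinter ▸ inter_subset_right, by omega, by omega⟩
  have hlin := affine_eq_sum_inter_supp 0 e x
  rw [hinter, hsum, Int.cast_zero, zero_add] at hlin
  simp only [hlin, maxCoord_eq_ite, ← card_pos]
  rcases hcard with h | h <;> simp [h]

lemma sqNorm_sub_maxCoord_le {f : Slice n k → ℝ} (hf : IsBoolean f) (e : Fin n → ℤ) :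
    sqNorm (fun x => f x - maxCoord (unitSet e) x) ≤
      sqNorm (fun x => f x - ∑ i, (e i : ℝ) * coord i x) +
        ∑ T ∈ badTraces 0 e, (𝔼 x : Slice n k, if T ⊆ x.1 then (1 : ℝ) else 0) := by
  simp only [sqNorm, ← expect_sum_comm, ← expect_add_distrib]
  refine expect_le_expect fun x _ => ?_
  have hnonneg : ∀ T ∈ badTraces 0 e, 0 ≤ if T ⊆ x.1 then (1 : ℝ) else 0 := fun T _ => by
    split_ifs <;> norm_num
  by_cases h : ∀ T ∈ badTraces 0 e, ¬T ⊆ x.1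
  · rw [linear_eq_maxCoord h]
    exact le_add_of_nonneg_right (sum_nonneg hnonneg)
  · push Not at h
    obtain ⟨T, hT, hTx⟩ := h
    have := single_le_sum hnonneg hT
    rw [if_pos hTx] at this
    exact (sq_sub_le_one (hf x) (isBoolean_maxCoord _ x)).trans
      (this.trans (le_add_of_nonneg_left (sq_nonneg _)))

lemma choose_two_mul_le_sum_badTraces (hkn : k ≤ n) (e : Fin n → ℤ) :
    ((#(unitSet e)).choose 2 : ℝ) * (k.choose 2 / n.choose 2) ≤
      ∑ T ∈ badTraces 0 e, (𝔼 x : Slice n k, if T ⊆ x.1 then (1 : ℝ) else 0) := by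
  have hpairs : powersetCard 2 (unitSet e) ⊆ badTraces 0 e := fun T hT => by
    obtain ⟨hTe, hT⟩ := mem_powersetCard.mp hT
    rw [mem_badTraces, sum_eq_card_of_subset_unitSet hTe, hT]
    exact ⟨hTe.trans (unitSet_subset_supp e), by norm_num, by norm_num⟩
  simp only [expect_subset hkn]
  refine le_trans (le_of_eq ?_) (sum_le_sum_of_subset_of_nonneg hpairs fun _ _ _ => by positivity)
  rw [sum_congr rfl fun T hT => by rw [(mem_powersetCard.mp hT).2], sum_const, card_powersetCard,
    nsmul_eq_mul]

lemma sq_le_four_mul_choose_two {m : ℕ} (hm : 2 ≤ m) : (m : ℝ) ^ 2 ≤ 4 * m.choose 2 := by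
  have : (2 : ℝ) ≤ m := by exact_mod_cast hm
  rw [Nat.cast_choose_two]
  nlinarith

lemma sq_le_eight_mul_choose_two_mul {g : ℕ} (hg : 2 ≤ g) (hk : 2 ≤ k) (hkn : k ≤ n) :
    (g * (k / n) : ℝ) ^ 2 ≤ 8 * (g.choose 2 * (k.choose 2 / n.choose 2)) := by
  have hn : (2 * n.choose 2 : ℝ) ≤ n ^ 2 := by
    rw [Nat.cast_choose_two]
    nlinarith [n.cast_nonneg (α := ℝ)]
  have hn₀ : (0 : ℝ) < n.choose 2 := by exact_mod_cast Nat.choose_pos (hk.trans hkn)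
  calc (g * (k / n) : ℝ) ^ 2
      = (g : ℝ) ^ 2 * (k ^ 2 / n ^ 2) := by rw [mul_pow, div_pow]
    _ ≤ (4 * g.choose 2 : ℝ) * (4 * k.choose 2 / (2 * n.choose 2)) := by
        gcongr
        exacts [sq_le_four_mul_choose_two hg, sq_le_four_mul_choose_two hk]
    _ = (8 : ℝ) * (g.choose 2 * (k.choose 2 / n.choose 2)) := by
        field_simp
        ring

end BadTraces

section Density

variable {n k : ℕ}

lemma density_of_two_mul_le (h : 2 * k ≤ n) : density n k = k / n := by
  have h' : (2 * k : ℝ) ≤ n := by exact_mod_cast h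
  have : (k : ℝ) / n ≤ 1 / 2 := div_le_of_le_mul₀ n.cast_nonneg (by norm_num) (by linarith)
  exact min_eq_left (by linarith)

lemma density_sub (hkn : k ≤ n) : density n (n - k) = density n k := by
  rcases n.eq_zero_or_pos with rfl | hn
  · rw [Nat.le_zero.mp hkn]
  · rw [density, density, Nat.cast_sub hkn, sub_div, div_self (by exact_mod_cast hn.ne'),
      sub_sub_cancel, min_comm]

lemma density_pos (hk : 0 < k) (hkn : k < n) : 0 < density n k := by
  have hk' : (0 : ℝ) < k := by exact_mod_cast hk
  have hkn' : (k : ℝ) < n := by exact_mod_cast hkn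
  have hn : (0 : ℝ) < n := hk'.trans hkn'
  exact lt_min (div_pos hk' hn) (sub_pos.mpr ((div_lt_one hn).mpr hkn'))

end Density

section LowerHalf

/-- A lower bound for the probability that a random point avoids the support of the integral
affine function produced by the rounding, conditionally on any trace. -/
noncomputable def avoidConst : ℝ := Real.exp (-60)

/-- The constant `C₁`, large enough for `1 ≤ C₁ * ε` to hold as soon as the rounding error
`3496 * ε` exceeds `2⁻¹⁸` or `avoidConst`. -/
noncomputable def errorConst : ℝ := 2 ^ 18 * (3496 * (1 + 1 / avoidConst))

/-- The constant `C₂`, read off from the bound `(#S * p) ^ 2 ≤ 8 * (3496 * ε / avoidConst)`. -/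
noncomputable def cardConst : ℝ := √(8 * 3496 / avoidConst)

lemma avoidConst_pos : 0 < avoidConst := Real.exp_pos _

lemma errorConst_pos : 0 < errorConst := by
  have := avoidConst_pos
  unfold errorConst
  positivity

lemma cardConst_pos : 0 < cardConst := by
  have := avoidConst_pos
  unfold cardConst
  positivity

variable {n k : ℕ}

lemma avoidConst_le_exp {s : ℕ} (hks : k * s ≤ 10 * n) :
    avoidConst ≤ Real.exp (-(6 * k * s / n)) := by
  have hks' : (k * s : ℝ) ≤ 10 * n := by exact_mod_cast hks
  refine Real.exp_le_exp.mpr (neg_le_neg (div_le_of_le_mul₀ n.cast_nonneg (by norm_num) ?_))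
  linarith

variable {f l : Slice n k → ℝ} {e : Fin n → ℤ} {ε η : ℝ}

lemma sum_badTraces_le_div {b : ℤ} (hkn : 2 * k ≤ n) (hs : 3 * #(supp e) ≤ n + 2)
    (hks : k * #(supp e) ≤ 10 * n) (hf : IsBoolean f)
    (hη : IsClose η f fun x => b + ∑ i, (e i : ℝ) * coord i x) :
    ∑ T ∈ badTraces b e, (𝔼 x : Slice n k, if T ⊆ x.1 then (1 : ℝ) else 0) ≤ η / avoidConst := by
  rw [le_div_iff₀' avoidConst_pos]
  refine le_trans ?_ (sum_badTraces_le hkn hs hf hη)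
  simp only [expect_subset (by omega : k ≤ n)]
  gcongr
  exact avoidConst_le_exp hks

lemma isClose_maxCoord_of_isClose_linear (hk : 2 ≤ k) (hkn : 2 * k ≤ n)
    (hs : 3 * #(supp e) ≤ n + 2) (hks : k * #(supp e) ≤ 10 * n) (hf : IsBoolean f)
    (hη : IsClose η f fun x => ∑ i, (e i : ℝ) * coord i x) :
    (#(unitSet e) : ℝ) ≤ max 1 (√(8 * (η / avoidConst)) / (k / n)) ∧
      IsClose (η + η / avoidConst) f (maxCoord (unitSet e)) := by
  have hbad := sum_badTraces_le_div (b := 0) hkn hs hks hf (by simpa using hη)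
  refine ⟨?_, (sqNorm_sub_maxCoord_le hf e).trans (add_le_add hη hbad)⟩
  rcases le_or_gt #(unitSet e) 1 with hU | hU
  · exact le_max_of_le_left (by exact_mod_cast hU)
  · have hp : (0 : ℝ) < k / n :=
      div_pos (by exact_mod_cast (by omega : 0 < k)) (by exact_mod_cast (by omega : 0 < n))
    refine le_max_of_le_right ((le_div_iff₀ hp).mpr (Real.le_sqrt_of_sq_le ?_))
    refine (sq_le_eight_mul_choose_two_mul hU hk (by omega)).trans ?_
    gcongr
    exact (choose_two_mul_le_sum_badTraces (by omega) e).trans hbad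

lemma cardConst_mul_sqrt_div (ε p : ℝ) :
    cardConst * (√ε / p) = √(8 * (3496 * ε / avoidConst)) / p := by
  rw [cardConst, ← mul_div_assoc, ← Real.sqrt_mul (div_nonneg (by norm_num) avoidConst_pos.le)]
  ring_nf

lemma lt_of_errorConst_mul_lt_one (hε : 0 ≤ ε) (h : errorConst * ε < 1) :
    3496 * ε ≤ 1 / 2 ^ 18 ∧ 3496 * ε < avoidConst := by
  have hκ := avoidConst_pos
  have hdiv : 0 ≤ 3496 * ε / avoidConst := by positivity
  have h' : 2 ^ 18 * (3496 * ε + 3496 * ε / avoidConst) < 1 := by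
    convert h using 1
    unfold errorConst
    ring
  exact ⟨by linarith, (div_lt_one hκ).mp (by linarith)⟩

lemma add_div_avoidConst_le (hε : 0 ≤ ε) :
    3496 * ε + 3496 * ε / avoidConst ≤ errorConst * ε := by
  have hdiv : 0 ≤ 3496 * ε / avoidConst := div_nonneg (by positivity) avoidConst_pos.le
  have : errorConst * ε = 2 ^ 18 * (3496 * ε + 3496 * ε / avoidConst) := by
    unfold errorConst
    ring
  linarith

lemma IsBoolean.isClose {D : Type} [Fintype D] {f g : D → ℝ} (hf : IsBoolean f)
    (hg : IsBoolean g) {δ : ℝ} (hδ : 1 ≤ δ) : IsClose δ f g := by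
  refine le_trans (expect_le_expect fun x _ => sq_sub_le_one (hf x) (hg x)) (le_trans ?_ hδ)
  rcases isEmpty_or_nonempty D with h | h <;> simp

theorem slice_fkn_of_two_mul_le (hk : 2 ≤ k) (hkn : 2 * k ≤ n) (hf : IsBoolean f)
    (hl : IsAffine l) (hε : IsClose ε f l) :
    ∃ S : Finset (Fin n), (#S : ℝ) ≤ max 1 (cardConst * (√ε / density n k)) ∧
      (IsClose (errorConst * ε) f (maxCoord S) ∨
        IsClose (errorConst * ε) (fun x => 1 - f x) (maxCoord S)) := by
  have hε₀ : 0 ≤ ε := (sqNorm_nonneg _).trans hε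
  rcases le_or_gt 1 (errorConst * ε) with hbig | hbig
  · exact ⟨∅, by simp, Or.inl (hf.isClose (isBoolean_maxCoord ∅) hbig)⟩
  obtain ⟨hsmall, hlt⟩ := lt_of_errorConst_mul_lt_one hε₀ hbig
  obtain ⟨b, e, hs, hks, he⟩ := exists_sparse_int_affine_isClose hk hkn hf hl hε hsmall
  have hb : b = 0 ∨ b = 1 := by
    by_contra! hb
    have := (one_le_sum_badTraces (by omega) e hb.1 hb.2).trans
      (sum_badTraces_le_div hkn hs hks hf he)
    rw [le_div_iff₀ avoidConst_pos] at this
    linarith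
  rw [density_of_two_mul_le hkn, cardConst_mul_sqrt_div]
  rcases hb with rfl | rfl
  · obtain ⟨hU, hclose⟩ := isClose_maxCoord_of_isClose_linear hk hkn hs hks hf (by simpa using he)
    exact ⟨_, hU, Or.inl (hclose.trans (add_div_avoidConst_le hε₀))⟩
  · have hsupp : supp (-e) = supp e := by simp [supp]
    obtain ⟨hU, hclose⟩ := isClose_maxCoord_of_isClose_linear (e := -e) hk hkn
      (hsupp ▸ hs) (hsupp ▸ hks) hf.one_sub (isClose_one_sub.mpr (by simpa using he))
    exact ⟨_, hU, Or.inr (hclose.trans (add_div_avoidConst_le hε₀))⟩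

end LowerHalf

section Duality

variable {n k : ℕ}

/-- Complementation as a bijection between complementary slices. -/
def complSlice (h : k ≤ n) : Slice n (n - k) ≃ Slice n k where
  toFun x := ⟨x.1ᶜ, by rw [card_compl, Fintype.card_fin, x.2]; omega⟩
  invFun x := ⟨x.1ᶜ, by rw [card_compl, Fintype.card_fin, x.2]⟩
  left_inv x := Subtype.ext (compl_compl x.1)
  right_inv x := Subtype.ext (compl_compl x.1)

lemma isClose_comp_equiv {D D' : Type} [Fintype D] [Fintype D'] (φ : D ≃ D') {ε : ℝ}
    {f g : D' → ℝ} : IsClose ε (fun x => f (φ x)) (fun x => g (φ x)) ↔ IsClose ε f g := by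
  unfold IsClose sqNorm
  rw [Fintype.expect_equiv φ _ (fun x => (f x - g x) ^ 2) fun _ => rfl]

lemma coord_complSlice (h : k ≤ n) (i : Fin n) (x : Slice n (n - k)) :
    coord i (complSlice h x) = 1 - coord i x := by
  by_cases hi : i ∈ x.1 <;> simp [coord, complSlice, hi]

lemma minCoord_complSlice (h : k ≤ n) (S : Finset (Fin n)) (x : Slice n (n - k)) :
    minCoord S (complSlice h x) = 1 - maxCoord S x := by
  unfold minCoord maxCoord
  induction S using Finset.induction_on with
  | empty => simp
  | insert i S hi ih => rw [fold_insert hi, fold_insert hi, ih, coord_complSlice, min_sub_sub_left]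

lemma IsAffine.comp_complSlice (h : k ≤ n) {l : Slice n k → ℝ} (hl : IsAffine l) :
    IsAffine fun x => l (complSlice h x) := by
  obtain ⟨c₀, c, hl⟩ := hl
  refine ⟨c₀ + ∑ i, c i, -c, fun x => ?_⟩
  simp only [hl, coord_complSlice, mul_sub, mul_one, sum_sub_distrib, Pi.neg_apply, neg_mul,
    sum_neg_distrib]
  ring

theorem slice_fkn_of_le_two_mul (hk : k + 2 ≤ n) (hkn : n ≤ 2 * k) {f l : Slice n k → ℝ}
    (hf : IsBoolean f) (hl : IsAffine l) {ε : ℝ} (hε : IsClose ε f l) :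
    ∃ S : Finset (Fin n), (#S : ℝ) ≤ max 1 (cardConst * (√ε / density n k)) ∧
      (IsClose (errorConst * ε) f (minCoord S) ∨
        IsClose (errorConst * ε) (fun x => 1 - f x) (minCoord S)) := by
  have hle : k ≤ n := by omega
  obtain ⟨S, hS, h⟩ := slice_fkn_of_two_mul_le (by omega) (by omega)
    (fun x => hf (complSlice hle x)) (hl.comp_complSlice hle)
    ((isClose_comp_equiv (complSlice hle)).mpr hε)
  have hmax : maxCoord S = fun x => 1 - minCoord S (complSlice hle x) := by
    funext x
    rw [minCoord_complSlice, sub_sub_cancel]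
  simp only [hmax, isClose_one_sub, sub_sub_cancel] at h
  rw [← isClose_one_sub, isClose_comp_equiv (complSlice hle) (f := fun x => 1 - f x),
    isClose_comp_equiv] at h
  exact ⟨S, density_sub hle ▸ hS, h.symm⟩

end Duality

section Dictators

variable {n k : ℕ}

lemma card_le_one_of_le_max {g : ℕ} {C ε p : ℝ} (hC : 0 < C) (hp : 0 < p)
    (hε : ε ≤ 1 / C ^ 2 * p ^ 2) (h : (g : ℝ) ≤ max 1 (C * (√ε / p))) : g ≤ 1 := by
  have hsqrt : √ε ≤ p / C := Real.sqrt_le_iff.mpr ⟨by positivity, hε.trans_eq (by ring)⟩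
  have : C * (√ε / p) ≤ 1 := by
    rw [mul_div_assoc', div_le_one hp]
    exact (le_div_iff₀' hC).mp hsqrt
  rw [max_eq_left this] at h
  exact_mod_cast h

lemma coord_mem_Icc (i : Fin n) (x : Slice n k) : coord i x ∈ Set.Icc (0 : ℝ) 1 := by
  unfold coord
  split_ifs <;> simp

lemma maxCoord_of_card_le_one {S : Finset (Fin n)} (hS : #S ≤ 1) :
    maxCoord (k := k) S = (fun _ => 0) ∨ ∃ i, maxCoord (k := k) S = coord i := by
  rcases Nat.le_one_iff_eq_zero_or_eq_one.mp hS with h | h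
  · exact Or.inl (by rw [card_eq_zero.mp h]; rfl)
  · obtain ⟨i, rfl⟩ := card_eq_one.mp h
    exact Or.inr ⟨i, funext fun x => by simp [maxCoord, (coord_mem_Icc i x).1]⟩

lemma minCoord_of_card_le_one {S : Finset (Fin n)} (hS : #S ≤ 1) :
    minCoord (k := k) S = (fun _ => 1) ∨ ∃ i, minCoord (k := k) S = coord i := by
  rcases Nat.le_one_iff_eq_zero_or_eq_one.mp hS with h | h
  · exact Or.inl (by rw [card_eq_zero.mp h]; rfl)
  · obtain ⟨i, rfl⟩ := card_eq_one.mp h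
    exact Or.inr ⟨i, funext fun x => by simp [minCoord, (coord_mem_Icc i x).2]⟩

lemma isClose_const_or_coord {f g : Slice n k → ℝ} {ε : ℝ}
    (hg : g = (fun _ => 0) ∨ g = (fun _ => 1) ∨ ∃ i, g = coord i)
    (h : IsClose ε f g ∨ IsClose ε (fun x => 1 - f x) g) :
    IsClose ε f (fun _ => 0) ∨ IsClose ε f (fun _ => 1) ∨
      ∃ i, IsClose ε f (coord i) ∨ IsClose ε f fun x => 1 - coord i x := by
  rw [isClose_one_sub] at h
  rcases hg with rfl | rfl | ⟨i, rfl⟩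
  · simp only [sub_zero] at h
    tauto
  · simp only [sub_self] at h
    tauto
  · exact Or.inr (Or.inr ⟨i, h⟩)

end Dictators

end SliceFKN

theorem mainTheorem1 :
    ∃ C₁ C₂ c : ℝ, 0 < C₁ ∧ 0 < C₂ ∧ 0 < c ∧
      ∀ (n k : ℕ), 2 ≤ k → k + 2 ≤ n →
      ∀ (f : SliceFKN.Slice n k → ℝ), SliceFKN.IsBoolean f →
      ∀ (ε : ℝ), (∃ l : SliceFKN.Slice n k → ℝ, SliceFKN.IsAffine l ∧ SliceFKN.IsClose ε f l) →
        (2 * k ≤ n →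
          ∃ S : Finset (Fin n),
            (S.card : ℝ) ≤ max 1 (C₂ * (Real.sqrt ε / SliceFKN.density n k)) ∧
            (SliceFKN.IsClose (C₁ * ε) f (SliceFKN.maxCoord S) ∨
              SliceFKN.IsClose (C₁ * ε) (fun x => 1 - f x) (SliceFKN.maxCoord S))) ∧
        (n ≤ 2 * k →
          ∃ S : Finset (Fin n),
            (S.card : ℝ) ≤ max 1 (C₂ * (Real.sqrt ε / SliceFKN.density n k)) ∧
            (SliceFKN.IsClose (C₁ * ε) f (SliceFKN.minCoord S) ∨
              SliceFKN.IsClose (C₁ * ε) (fun x => 1 - f x) (SliceFKN.minCoord S))) ∧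
        (ε ≤ c * SliceFKN.density n k ^ 2 →
          SliceFKN.IsClose (C₁ * ε) f (fun _ => 0) ∨
          SliceFKN.IsClose (C₁ * ε) f (fun _ => 1) ∨
          ∃ i : Fin n,
            SliceFKN.IsClose (C₁ * ε) f (SliceFKN.coord i) ∨
            SliceFKN.IsClose (C₁ * ε) f (fun x => 1 - SliceFKN.coord i x)) := by
  have hC := SliceFKN.cardConst_pos
  refine ⟨SliceFKN.errorConst, SliceFKN.cardConst, 1 / SliceFKN.cardConst ^ 2,
    SliceFKN.errorConst_pos, hC, by positivity, ?_⟩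
  rintro n k hk hkn f hf ε ⟨l, hl, hε⟩
  have lower := fun h : 2 * k ≤ n => SliceFKN.slice_fkn_of_two_mul_le hk h hf hl hε
  have upper := fun h : n ≤ 2 * k => SliceFKN.slice_fkn_of_le_two_mul hkn h hf hl hε
  refine ⟨lower, upper, fun hsmall => ?_⟩
  have card_le_one {S : Finset (Fin n)} := SliceFKN.card_le_one_of_le_max (g := S.card) hC
    (SliceFKN.density_pos (by omega : 0 < k) (by omega)) hsmall
  rcases le_total (2 * k) n with h | h
  · obtain ⟨S, hS, hclose⟩ := lower h
    exact SliceFKN.isClose_const_or_coord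
      ((SliceFKN.maxCoord_of_card_le_one (card_le_one hS)).imp_right Or.inr) hclose
  · obtain ⟨S, hS, hclose⟩ := upper h
    exact SliceFKN.isClose_const_or_coord
      (Or.inr (SliceFKN.minCoord_of_card_le_one (card_le_one hS))) hclose
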